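/- Let $a\in(0,\tfrac12]$. Put $x_A=\frac{4+\pi}{6\pi}$, $x_B=\frac{1+\pi}{3\pi}$, $y_A=\frac12(x_A^2+a^2)^{3/4}$, $y_B=\frac12(x_B^2+a^2)^{1/2}$, and for $x\in\mathbb R$ let $y_{x,a}=\frac12(x^2+a^2)^{3/4}$ if $|x|\le x_A$, $y_{x,a}=\frac12(x^2+a^2)^{1/2}$ if $|x|\ge x_B$, and $y_{x,a}=y_A+(y_B-y_A)\frac{|x|-x_A}{x_B-x_A}$ if $x_A\le|x|\le x_B$. Let $$\Omega_a=\{x+iy\in\mathbb C : |y|\le y_{x,a}\},\qquad g_a(z)=e^{\frac{i}{a}\arctan(z/a)},$$ $$F_a(z)=\operatorname{Re}\int_0^z\Big(\tfrac12\big(g_a^{-1}-g_a\big),\ \tfrac i2\big(g_a^{-1}+g_a\big),\ 1\Big)\,d\zeta,\qquad z\in\Omega_a$$ (integration along any path in the simply connected set $\Omega_a$), the Weierstrass immersion with data $(g_a,dz)$, and let $\Sigma_a=F_a(\Omega_a)\subset\mathbb R^3$. Then there is $R_0>0$, independent of $a$, such that for every $a\in(0,\tfrac12]$: 1. $\Sigma_a\cap\{x_1^2+x_2^2\le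 R_0^2\}$ is a minimal disk properly embedded in the closed cylinder $\{x_1^2+x_2^2\le R_0^2\}$. That is, $D=\{z\in\Omega_a: F_a(z)\in\{x_1^2+x_2^2\le R_0^2\}\}$ is a smooth disk (diffeomorphic to the closed unit disk with a closed subset of the unit circle removed), and $F_a|_D$ is a smooth injective immersion with zero mean curvature, proper as a map into the cylinder, sending exactly the boundary of $D$ to the boundary of the cylinder. 2. $\{0<x_1^2+x_2^2<R_0^2\}\cap\Sigma_a$ is the union of two disjoint multi-valued graphs over the punctured disk $D_{R_0}(0)\setminus\{0\}$, that is, of two disjoint sets of the form $\{(\rho\cos\theta,\rho\sin\theta,w(\rho,\theta)) : 0<\rho<R_0,\ \theta\in I\}$, where $I\subset\mathbb R$ is an open interval of length at least $2\pi$ and $w$ is a smooth function on $(0,R_0)\times I$. -/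

import Mathlib

open scoped ContDiff

namespace HelicoidalDisks

noncomputable section

/-- Euclidean three-space; the coordinates `x₁, x₂, x₃` are `p 0, p 1, p 2`. -/
abbrev E3 : Type := EuclideanSpace ℝ (Fin 3)

/-! ### The domains -/

/-- `x_A = 1/π + (1/2 - 1/π)/3`. -/
def xA : ℝ := 1 / Real.pi + (1 / 2 - 1 / Real.pi) * (1 / 3)

/-- `x_B = 1/π + 2(1/2 - 1/π)/3`. -/
def xB : ℝ := 1 / Real.pi + (1 / 2 - 1 / Real.pi) * (2 / 3)

/-- `y_A = (x_A² + a²)^{3/4} / 2`. -/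
def yA (a : ℝ) : ℝ := (xA ^ 2 + a ^ 2) ^ (3 / 4 : ℝ) / 2

/-- `y_B = (x_B² + a²)^{1/2} / 2`. -/
def yB (a : ℝ) : ℝ := (xB ^ 2 + a ^ 2) ^ (1 / 2 : ℝ) / 2

/-- The half-height `y_{x,a}` of the domain over the abscissa `x`: the two power laws for
`|x| ≤ x_A` and `|x| ≥ x_B`, joined by line segments on `x_A ≤ x ≤ x_B` and
`-x_B ≤ x ≤ -x_A`. -/
def halfHeight (a x : ℝ) : ℝ :=
  if |x| ≤ xA then (x ^ 2 + a ^ 2) ^ (3 / 4 : ℝ) / 2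
  else if xB ≤ |x| then (x ^ 2 + a ^ 2) ^ (1 / 2 : ℝ) / 2
  else if 0 ≤ x then yA a + (yB a - yA a) * ((x - xA) / (xB - xA))
  else yA a + (yB a - yA a) * ((x + xA) / (xA - xB))

/-- The unbounded domain `Ω_a`, with `z = x + i y`. -/
def Omega (a : ℝ) : Set ℂ := {z | |z.im| ≤ halfHeight a z.re}

/-! ### The Weierstrass immersion -/

/-- `g_a = e^{i h_a}`, `h_a(z) = arctan(z/a)/a`. -/
def gauss (a : ℝ) (z : ℂ) : ℂ :=
  Complex.exp (Complex.I * ((1 / (a : ℂ)) * Complex.arctan (z / (a : ℂ))))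

/-- The Weierstrass immersion with data `(g_a, dz)` and base point `0`, that is
`Re ∫ (½(g⁻¹ - g), (i/2)(g⁻¹ + g), 1) dζ`, the integral being taken along the path from `0` to
`z` made of the horizontal segment from `0` to `Re z` and the vertical segment from `Re z` to `z`.
This path lies in `Ω_a` when `z` does, and on the simply connected set `Ω_a`, where the integrand
is holomorphic, the integral does not depend on the path. -/
def Fmap (a : ℝ) (z : ℂ) : E3 :=
  !₂[(Complex.wedgeIntegral 0 z fun ζ => (1 / 2) * ((gauss a ζ)⁻¹ - gauss a ζ)).re,
     (Complex.wedgeIntegral 0 z fun ζ => (Complex.I / 2) * ((gauss a ζ)⁻¹ + gauss a ζ)).re,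
     (Complex.wedgeIntegral 0 z fun _ => (1 : ℂ)).re]

/-- The surface `Σ_a = F_a(Ω_a)`. -/
def Sigma (a : ℝ) : Set E3 := Fmap a '' Omega a

/-- The closed solid cylinder `{x₁² + x₂² ≤ R²}`. -/
def cylinder (R : ℝ) : Set E3 := {p | p 0 ^ 2 + p 1 ^ 2 ≤ R ^ 2}

/-- The open solid cylinder without its axis, `{0 < x₁² + x₂² < R²}`. -/
def puncturedCylinder (R : ℝ) : Set E3 :=
  {p | 0 < p 0 ^ 2 + p 1 ^ 2 ∧ p 0 ^ 2 + p 1 ^ 2 < R ^ 2}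

/-! ### Parametrized surfaces and mean curvature -/

/-- `∂X/∂x`. -/
def dx (X : ℂ → E3) (z : ℂ) : E3 := fderiv ℝ X z 1

/-- `∂X/∂y`. -/
def dy (X : ℂ → E3) (z : ℂ) : E3 := fderiv ℝ X z Complex.I

/-- The cross product of two vectors of `ℝ³`. -/
def cross (v w : E3) : E3 :=
  WithLp.toLp 2 (crossProduct (WithLp.ofLp v) (WithLp.ofLp w))

/-- The unit normal of a parametrized surface (at points where it is immersed). -/
def unitNormal (X : ℂ → E3) (z : ℂ) : E3 :=
  ‖cross (dx X z) (dy X z)‖⁻¹ • cross (dx X z) (dy X z)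

/-- The mean curvature `(e G - 2 f F + g E) / (2 (E G - F²))` of a parametrized surface, in terms
of the coefficients `E, F, G` of the first and `e, f, g` of the second fundamental form. -/
def meanCurvature (X : ℂ → E3) (z : ℂ) : ℝ :=
  (inner ℝ (dx (dx X) z) (unitNormal X z) * inner ℝ (dy X z) (dy X z)
      - 2 * inner ℝ (dx (dy X) z) (unitNormal X z) * inner ℝ (dx X z) (dy X z)
      + inner ℝ (dy (dy X) z) (unitNormal X z) * inner ℝ (dx X z) (dx X z))
    / (2 * (inner ℝ (dx X z) (dx X z) * inner ℝ (dy X z) (dy X z) - inner ℝ (dx X z) (dy X z) ^ 2))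

/-! ### Properly embedded minimal disks -/

/-- `f` is smooth on `D`, up to and including the boundary points that belong to `D`: it is smooth
on an open neighbourhood of `D`. -/
def SmoothNear {V : Type} [NormedAddCommGroup V] [NormedSpace ℝ V] (f : ℂ → V) (D : Set ℂ) : Prop :=
  ∃ U : Set ℂ, IsOpen U ∧ D ⊆ U ∧ ContDiffOn ℝ ∞ f U

/-- `D` is a smooth disk (possibly with boundary, possibly non-compact): it is diffeomorphic to
the closed unit disk with a closed subset `K` of the unit circle removed. For `K = ∅` this is a
compact disk, for `K` the whole circle an open disk, and for `K` a pair of points a closed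
strip. -/
def IsSmoothDisk (D : Set ℂ) : Prop :=
  ∃ K : Set ℂ, IsClosed K ∧ K ⊆ Metric.sphere (0 : ℂ) 1 ∧
    ∃ φ ψ : ℂ → ℂ,
      SmoothNear φ D ∧ SmoothNear ψ (Metric.closedBall (0 : ℂ) 1 \ K) ∧
      Set.MapsTo φ D (Metric.closedBall (0 : ℂ) 1 \ K) ∧
      Set.MapsTo ψ (Metric.closedBall (0 : ℂ) 1 \ K) D ∧
      Set.InvOn ψ φ D (Metric.closedBall (0 : ℂ) 1 \ K)

/-- The map `X` on `D` parametrizes `S` as a minimal disk properly embedded in the closed region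
`C`: `D` is a disk, and `X` is a smooth, injective, proper immersion of `D` into `C` with image `S`
and zero mean curvature, under which exactly the boundary of `D` goes to the boundary of `C`. -/
structure IsProperlyEmbeddedMinimalDisk (X : ℂ → E3) (D : Set ℂ) (C S : Set E3) : Prop where
  disk : IsSmoothDisk D
  smooth : SmoothNear X D
  immersion : ∀ z ∈ D, Function.Injective (fderiv ℝ X z)
  minimal : ∀ z ∈ D, meanCurvature X z = 0
  injOn : Set.InjOn X D
  image_eq : X '' D = S
  mapsTo : Set.MapsTo X D C
  proper : ∀ Q : Set E3, Q ⊆ C → IsCompact Q → IsCompact (D ∩ X ⁻¹' Q)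
  boundary : ∀ z ∈ D, X z ∈ frontier C ↔ z ∈ frontier D

/-! ### Multi-valued graphs -/

/-- `S` is a multi-valued graph over the punctured disk `D_R(0) ∖ {0}`: the graph of a smooth
function `w` of the polar coordinates `(ρ, θ)` on the universal cover of the punctured plane, over
`0 < ρ < R` and `θ` in an open interval covering at least one full turn. -/
def IsMultivaluedGraph (R : ℝ) (S : Set E3) : Prop :=
  ∃ α β : ℝ, 2 * Real.pi ≤ β - α ∧
    ∃ w : ℝ × ℝ → ℝ, ContDiffOn ℝ ∞ w (Set.Ioo 0 R ×ˢ Set.Ioo α β) ∧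
      S = (fun q : ℝ × ℝ => (!₂[q.1 * Real.cos q.2, q.1 * Real.sin q.2, w q] : E3)) ''
        (Set.Ioo 0 R ×ˢ Set.Ioo α β)

end

end HelicoidalDisks

/-! Write `expo a` as h = u + iv, so that h' = 1/(z² + a²), and let T be `turned a`. The third
coordinate of the immersion is x = Re z, so the slice of the surface at height x is, up to a quarter
turn, the plane curve t ↦ T(x + it). It passes through 0 at t = 0 and has velocity cosh v · e^{iu}:
u is its direction and cosh v its speed. Two estimates, uniform in a, carry the proof.

Direction: along each half of a vertical segment of Ω_a, u varies by less than 3/2 < π/2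
(`Omega_subset_good`, `abs_expo_re_sub_lt`). The curve therefore never turns back, and its distance
|T| from the axis increases strictly (`normSq_turned_lt`).

Speed: each curve leaves a disk of fixed radius before it leaves Ω_a (`exists_exit`). When s = x² +
a² is small, only the height s^{3/4}/2 is available, but v grows at least like t/s, and the growth
of cosh compensates.

Consequently the preimage of the cylinder is a strip |y| ≤ η(x) with η smooth and positive, hence a
disk. Injectivity follows from the monotonicity of |T| together with T(conj z) = -T(z). Minimality
is the usual fact about real parts of holomorphic null curves.

For the graphs, follow the level curve |T| = r in the upper half of the strip, parametrized by x.
Its polar angle increases strictly (`hasDerivAt_angle`), from -π/(2a) to π/(2a) (`range_angle`).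
Hence log T maps the upper half diffeomorphically onto a half strip of width π/a ≥ 2π, and x as a
function of log T is the graph function. The lower half is the same graph turned by π. -/

namespace HelicoidalDisks
open Complex Set

/-! ### Primitives by wedge integrals -/

/-- On an open set that contains the real axis and, with each point, the vertical segment down to
the real axis and its mirror image, the wedge integral from `0` of a holomorphic function is a
primitive. -/
theorem hasDerivAt_wedgeIntegral_zero {U : Set ℂ} (hU : IsOpen U) (hre : ∀ x : ℝ, (x : ℂ) ∈ U)
    (hv : ∀ z ∈ U, ∀ t : ℝ, |t| ≤ |z.im| → (z.re + t * I : ℂ) ∈ U) {f : ℂ → ℂ}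
    (hf : DifferentiableOn ℂ f U) {z : ℂ} (hz : z ∈ U) :
    HasDerivAt (fun w => wedgeIntegral 0 w f) (f z) z := by
  obtain ⟨r, hr, hball⟩ := Metric.isOpen_iff.mp hU z hz
  have hloc : HasDerivAt (fun w => wedgeIntegral z w f) (f z) z :=
    ((hf.mono hball).isConservativeOn).hasDerivAt_wedgeIntegral (hf.mono hball).continuousOn
      (Metric.mem_ball_self hr)
  have hc := hf.continuousOn
  have key : ∀ᶠ w in nhds z, wedgeIntegral 0 w f = wedgeIntegral z w f + wedgeIntegral 0 z f := by
    filter_upwards [Metric.ball_mem_nhds z hr] with w hw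
    have hwU : w ∈ U := hball hw
    have vert : ∀ c ∈ U, ∀ b₁ b₂ : ℝ, |b₁| ≤ |c.im| → |b₂| ≤ |c.im| →
        IntervalIntegrable (fun y : ℝ => f (c.re + y * I)) MeasureTheory.volume b₁ b₂ := by
      intro c hcU b₁ b₂ h1 h2
      refine ContinuousOn.intervalIntegrable (hc.comp (by fun_prop) ?_)
      intro y hy
      refine hv c hcU y ?_
      rw [mem_uIcc] at hy
      rcases hy with hy | hy
      · exact (abs_le_max_abs_abs hy.1 hy.2).trans (max_le h1 h2)
      · exact (abs_le_max_abs_abs hy.1 hy.2).trans (max_le h2 h1)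
    have horiz : ∀ b₁ b₂ : ℝ,
        IntervalIntegrable (fun x : ℝ => f (x + (0 : ℝ) * I)) MeasureTheory.volume b₁ b₂ := by
      intro b₁ b₂
      refine ContinuousOn.intervalIntegrable (hc.comp (by fun_prop) ?_)
      intro y _
      simpa using hre y
    have hmid : ∀ x ∈ uIcc z.re w.re, (⟨x, z.im⟩ : ℂ) ∈ U := by
      intro x hx
      apply hball
      rw [Metric.mem_ball, Complex.dist_eq] at hw ⊢
      refine lt_of_le_of_lt ?_ ((Complex.abs_re_le_norm (w - z)).trans_lt hw)
      have : ((⟨x, z.im⟩ : ℂ) - z) = ((x - z.re : ℝ) : ℂ) := by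
        apply Complex.ext <;> simp
      rw [this, Complex.norm_real, Real.norm_eq_abs]
      simpa using Set.abs_sub_left_of_mem_uIcc hx
    -- The paths 0 → w and 0 → z → w differ by the boundary of the rectangle between the real axis
    -- and the height Im z. Its top edge lies in the ball, so vertical convexity keeps the whole
    -- rectangle in `U`.
    have hrect : Rectangle (z.re : ℂ) (⟨w.re, z.im⟩ : ℂ) ⊆ U := by
      rintro p ⟨hp1, hp2⟩
      simp only [mem_preimage, ofReal_re, ofReal_im] at hp1 hp2
      have := hv _ (hmid p.re hp1) p.im (by
        rcases mem_uIcc.mp hp2 with h | h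
        · simpa [abs_of_nonneg h.1] using h.2.trans (le_abs_self _)
        · simpa [abs_of_nonpos h.2, abs_of_nonpos (h.1.trans h.2)] using h.1)
      simpa using this
    have hcons := (hf.mono hrect).isConservativeOn _ _ subset_rfl
    rw [← add_eq_zero_iff_eq_neg, wedgeIntegral_add_wedgeIntegral_eq] at hcons
    have hwz : (⟨w.re, z.im⟩ : ℂ) ∈ U := hmid _ right_mem_uIcc
    have e1 := intervalIntegral.integral_add_adjacent_intervals (horiz 0 z.re) (horiz z.re w.re)
    have hVw : IntervalIntegrable (fun y : ℝ => f (w.re + y * I)) MeasureTheory.volume 0 z.im := by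
      simpa using vert _ hwz 0 z.im (by simp) (by simp)
    have hVw' : IntervalIntegrable (fun y : ℝ => f (w.re + y * I)) MeasureTheory.volume 0 w.im :=
      vert _ hwU 0 w.im (by simp) (by simp)
    have e2 := intervalIntegral.integral_add_adjacent_intervals hVw (hVw.symm.trans hVw')
    simp only [wedgeIntegral, zero_re, zero_im, smul_eq_mul, ofReal_re, ofReal_im] at hcons e1 e2 ⊢
    linear_combination hcons - e1 - I * e2
  exact (hloc.add_const (wedgeIntegral 0 z f)).congr_of_eventuallyEq key

/-! ### The complex arctangent and the exponent of the Gauss map -/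

/-- Keeps the logarithm that defines `Complex.arctan` off its cut: the quotient is real only for
imaginary z, and then Re(1 + z²) > 0 means |z| < 1, which makes it positive. -/
theorem one_add_mul_I_div_mem_slitPlane {z : ℂ} (hz : 0 < (1 + z ^ 2).re) :
    (1 + z * I) / (1 - z * I) ∈ slitPlane := by
  have h0 : 1 + z ^ 2 ≠ 0 := fun h => by simp [h] at hz
  have hfac : (1 + z * I) * (1 - z * I) = 1 + z ^ 2 := by linear_combination -z ^ 2 * I_sq
  have h1 : 1 + z * I ≠ 0 := fun h => h0 (by rw [← hfac, h, zero_mul])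
  have h2 : 1 - z * I ≠ 0 := fun h => h0 (by rw [← hfac, h, mul_zero])
  have hn : 0 < normSq (1 - z * I) := normSq_pos.mpr h2
  rw [mem_slitPlane_iff]
  have e1 : ((1 + z * I) / (1 - z * I)).re = (1 - z.re ^ 2 - z.im ^ 2) / normSq (1 - z * I) := by
    rw [div_re]; simp; field_simp; ring
  have e2 : ((1 + z * I) / (1 - z * I)).im = 2 * z.re / normSq (1 - z * I) := by
    rw [div_im]; simp; field_simp; ring
  rw [e1, e2]
  by_cases hx : z.re = 0
  · left
    refine div_pos ?_ hn
    simp [pow_two, hx] at hz ⊢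
    linarith
  · right
    exact div_ne_zero (by simpa using hx) hn.ne'

theorem hasDerivAt_arctan {z : ℂ} (hz : 0 < (1 + z ^ 2).re) :
    HasDerivAt Complex.arctan (1 / (1 + z ^ 2)) z := by
  have hslit := one_add_mul_I_div_mem_slitPlane hz
  have h0 : 1 + z ^ 2 ≠ 0 := fun h => by simp [h] at hz
  have hfac : (1 + z * I) * (1 - z * I) = 1 + z ^ 2 := by linear_combination -z ^ 2 * I_sq
  have h1 : 1 + z * I ≠ 0 := fun h => h0 (by rw [← hfac, h, zero_mul])
  have h2 : 1 - z * I ≠ 0 := fun h => h0 (by rw [← hfac, h, mul_zero])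
  have hd : HasDerivAt (fun z : ℂ => (1 + z * I) / (1 - z * I))
      ((I * (1 - z * I) - (1 + z * I) * (-I)) / (1 - z * I) ^ 2) z := by
    have hA : HasDerivAt (fun z : ℂ => 1 + z * I) I z := by
      simpa using ((hasDerivAt_id z).mul_const I).const_add 1
    have hB : HasDerivAt (fun z : ℂ => 1 - z * I) (-I) z := by
      simpa using ((hasDerivAt_id z).mul_const I).const_sub 1
    exact hA.div hB h2
  have := (hd.clog hslit).const_mul (-I / 2)
  refine this.congr_deriv ?_
  rw [← hfac, show I * (1 - z * I) - (1 + z * I) * -I = 2 * I by ring]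
  generalize 1 + z * I = A at h1
  generalize 1 - z * I = B at h2
  field_simp
  linear_combination -I_sq

/-- The domain `|y|² < x² + a²`, on which the Gauss map is holomorphic. -/
def dom (a : ℝ) : Set ℂ := {z | z.im ^ 2 < z.re ^ 2 + a ^ 2}

theorem isOpen_dom (a : ℝ) : IsOpen (dom a) :=
  isOpen_lt (by fun_prop) (by fun_prop)

/-- The exponent `h_a(z) = arctan(z/a)/a` of the Gauss map. -/
noncomputable def expo (a : ℝ) (z : ℂ) : ℂ := (1 / (a : ℂ)) * Complex.arctan (z / (a : ℂ))

theorem sq_add_sq_re (a : ℝ) (z : ℂ) : (z ^ 2 + (a : ℂ) ^ 2).re = z.re ^ 2 + a ^ 2 - z.im ^ 2 := by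
  simp [pow_two]; ring

theorem sq_add_sq_im (a : ℝ) (z : ℂ) : (z ^ 2 + (a : ℂ) ^ 2).im = 2 * z.re * z.im := by
  simp [pow_two]; ring

theorem sq_add_sq_ne_zero {a : ℝ} {z : ℂ} (hz : z ∈ dom a) : z ^ 2 + (a : ℂ) ^ 2 ≠ 0 := by
  intro h
  have := sq_add_sq_re a z
  rw [h, zero_re] at this
  have hz' : z.im ^ 2 < z.re ^ 2 + a ^ 2 := hz
  linarith

theorem one_add_div_sq_re_pos {a : ℝ} (ha : 0 < a) {z : ℂ} (hz : z ∈ dom a) :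
    0 < (1 + (z / (a : ℂ)) ^ 2).re := by
  have ha' : (a : ℂ) ≠ 0 := by exact_mod_cast ha.ne'
  have hz' : z.im ^ 2 < z.re ^ 2 + a ^ 2 := hz
  have : 1 + (z / (a : ℂ)) ^ 2 = (z ^ 2 + (a : ℂ) ^ 2) / ((a ^ 2 : ℝ) : ℂ) := by
    push_cast; field_simp; ring
  rw [this, div_ofReal_re, sq_add_sq_re]
  apply div_pos <;> nlinarith

theorem hasDerivAt_expo {a : ℝ} (ha : 0 < a) {z : ℂ} (hz : z ∈ dom a) :
    HasDerivAt (expo a) (1 / (z ^ 2 + (a : ℂ) ^ 2)) z := by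
  have ha' : (a : ℂ) ≠ 0 := by exact_mod_cast ha.ne'
  have hne := sq_add_sq_ne_zero hz
  have hpos := one_add_div_sq_re_pos ha hz
  have := ((hasDerivAt_arctan hpos).comp z ((hasDerivAt_id z).div_const (a : ℂ))).const_mul
    (1 / (a : ℂ))
  refine this.congr_deriv ?_
  have h1 : 1 + (z / (a : ℂ)) ^ 2 = (z ^ 2 + (a : ℂ) ^ 2) / (a : ℂ) ^ 2 := by
    field_simp; ring
  rw [h1]
  field_simp

theorem expo_ofReal (a x : ℝ) : expo a x = ((Real.arctan (x / a) / a : ℝ) : ℂ) := by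
  rw [expo, ← ofReal_div, ← ofReal_arctan]; push_cast; ring

/-! ### The null curve and its horizontal projection -/

/-- The two nonconstant Weierstrass forms in terms of the exponent. -/
theorem gauss_sub (a : ℝ) (ζ : ℂ) :
    (1 / 2) * ((gauss a ζ)⁻¹ - gauss a ζ) = -I * Complex.sin (expo a ζ) := by
  have : gauss a ζ = cexp (expo a ζ * I) := by rw [gauss, expo, mul_comm]
  rw [this, ← Complex.exp_neg, Complex.sin]
  simp only [neg_mul]
  linear_combination (1/2) * (cexp (-(expo a ζ * I)) - cexp (expo a ζ * I)) * I_sq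

theorem gauss_add (a : ℝ) (ζ : ℂ) :
    (I / 2) * ((gauss a ζ)⁻¹ + gauss a ζ) = I * Complex.cos (expo a ζ) := by
  have : gauss a ζ = cexp (expo a ζ * I) := by rw [gauss, expo, mul_comm]
  rw [this, ← Complex.exp_neg, Complex.cos, neg_mul]
  ring

theorem wedgeIntegral_one (z : ℂ) : wedgeIntegral 0 z (fun _ => (1 : ℂ)) = z := by
  simp [wedgeIntegral, mul_comm I]

/-- The holomorphic null curve whose real part is the immersion. -/
noncomputable def primS (a : ℝ) (z : ℂ) : ℂ :=
  wedgeIntegral 0 z fun ζ => -I * Complex.sin (expo a ζ)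

noncomputable def primC (a : ℝ) (z : ℂ) : ℂ :=
  wedgeIntegral 0 z fun ζ => I * Complex.cos (expo a ζ)

theorem Fmap_eq (a : ℝ) (z : ℂ) : Fmap a z = !₂[(primS a z).re, (primC a z).re, z.re] := by
  simp only [Fmap, gauss_sub, gauss_add, wedgeIntegral_one, primS, primC]

theorem dom_vert {a : ℝ} (z : ℂ) (hz : z ∈ dom a) (t : ℝ) (ht : |t| ≤ |z.im|) :
    (z.re + t * I : ℂ) ∈ dom a := by
  have hz' : z.im ^ 2 < z.re ^ 2 + a ^ 2 := hz
  have := sq_le_sq.mpr ht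
  simp only [dom, mem_ofPred_eq, add_im, ofReal_im, mul_im, ofReal_re, I_im, I_re, add_re, mul_re]
  nlinarith

theorem ofReal_mem_dom {a : ℝ} (ha : 0 < a) (x : ℝ) : (x : ℂ) ∈ dom a := by
  change (x : ℂ).im ^ 2 < (x : ℂ).re ^ 2 + a ^ 2
  simp only [ofReal_im, ofReal_re]
  have := sq_nonneg x
  have := pow_pos ha 2
  linarith

theorem hasDerivAt_primS {a : ℝ} (ha : 0 < a) {z : ℂ} (hz : z ∈ dom a) :
    HasDerivAt (primS a) (-I * Complex.sin (expo a z)) z :=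
  hasDerivAt_wedgeIntegral_zero (isOpen_dom a) (ofReal_mem_dom ha) dom_vert
    (f := fun ζ => -I * Complex.sin (expo a ζ))
    (fun _ hw => ((hasDerivAt_expo ha hw).csin.const_mul (-I)).differentiableAt.differentiableWithinAt)
    hz

theorem hasDerivAt_primC {a : ℝ} (ha : 0 < a) {z : ℂ} (hz : z ∈ dom a) :
    HasDerivAt (primC a) (I * Complex.cos (expo a z)) z :=
  hasDerivAt_wedgeIntegral_zero (isOpen_dom a) (ofReal_mem_dom ha) dom_vert
    (f := fun ζ => I * Complex.cos (expo a ζ))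
    (fun _ hw => ((hasDerivAt_expo ha hw).ccos.const_mul I).differentiableAt.differentiableWithinAt)
    hz

/-- The horizontal part of the immersion as a complex number, turned by a quarter turn:
`T = i (x₁ + i x₂)`. -/
noncomputable def turned (a : ℝ) (z : ℂ) : ℂ := I * (primS a z).re - (primC a z).re

/-- On the real axis the exponent is real, so both horizontal forms are purely imaginary there: the
real axis goes to the axis of the cylinder. -/
theorem turned_ofReal (a x : ℝ) : turned a x = 0 := by
  have h1 : (primS a x).re = 0 := by
    simp only [primS, wedgeIntegral, zero_re, zero_im, ofReal_re, ofReal_im,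
      intervalIntegral.integral_same, smul_zero, add_zero, ofReal_zero, zero_mul, expo_ofReal,
      ← ofReal_sin, intervalIntegral.integral_const_mul, intervalIntegral.integral_ofReal]
    simp
  have h2 : (primC a x).re = 0 := by
    simp only [primC, wedgeIntegral, zero_re, zero_im, ofReal_re, ofReal_im,
      intervalIntegral.integral_same, smul_zero, add_zero, ofReal_zero, zero_mul, expo_ofReal,
      ← ofReal_cos, intervalIntegral.integral_const_mul, intervalIntegral.integral_ofReal]
    simp
  simp [turned, h1, h2]

/-- The differential of `turned`. -/
noncomputable def turnedDeriv (a : ℝ) (z : ℂ) : ℂ →L[ℝ] ℂ :=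
  reCLM.smulRight (I * Real.sinh (expo a z).im * cexp ((expo a z).re * I)) +
    imCLM.smulRight (Real.cosh (expo a z).im * cexp ((expo a z).re * I))

theorem turnedDeriv_apply (a : ℝ) (z w : ℂ) : turnedDeriv a z w =
    (w.re * (I * Real.sinh (expo a z).im) + w.im * Real.cosh (expo a z).im) *
      cexp ((expo a z).re * I) := by
  simp [turnedDeriv, -ofReal_sinh, -ofReal_cosh]; ring

/-- With h = u + iv, the addition formulas for sin h and cos h assemble the two real parts into T_x
= i sinh v · e^{iu} and T_y = cosh v · e^{iu}. -/
theorem hasFDerivAt_turned {a : ℝ} (ha : 0 < a) {z : ℂ} (hz : z ∈ dom a) :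
    HasFDerivAt (turned a) (turnedDeriv a z) z := by
  have h1 := (reCLM.hasFDerivAt.comp z ((hasDerivAt_primS ha hz).hasFDerivAt.restrictScalars ℝ))
  have h2 := (reCLM.hasFDerivAt.comp z ((hasDerivAt_primC ha hz).hasFDerivAt.restrictScalars ℝ))
  have h := ((ofRealCLM.hasFDerivAt.comp z h1).const_mul I).sub (ofRealCLM.hasFDerivAt.comp z h2)
  refine h.congr_fderiv ?_
  ext w
  rw [turnedDeriv_apply]
  set u := (expo a z).re
  set v := (expo a z).im
  have e : expo a z = u + v * I := (re_add_im _).symm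
  have hs : Complex.sin (expo a z) =
      (Real.sin u * Real.cosh v : ℝ) + (Real.cos u * Real.sinh v : ℝ) * I := by
    rw [e, sin_add_mul_I]; push_cast; ring
  have hc : Complex.cos (expo a z) =
      (Real.cos u * Real.cosh v : ℝ) - (Real.sin u * Real.sinh v : ℝ) * I := by
    rw [e, cos_add_mul_I]; push_cast; ring
  rw [exp_mul_I, ← ofReal_cos, ← ofReal_sin]
  apply Complex.ext <;>
    simp [hs, hc, -ofReal_sinh, -ofReal_cosh, -ofReal_sin, -ofReal_cos] <;> ring

/-! ### Direction of the slice curves and monotonicity of the distance -/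

theorem le_of_hasDerivAt_nonneg {f f' : ℝ → ℝ} {p q : ℝ} (hpq : p ≤ q)
    (h : ∀ t ∈ Icc p q, HasDerivAt f (f' t) t) (h0 : ∀ t ∈ Icc p q, 0 ≤ f' t) : f p ≤ f q := by
  refine monotoneOn_of_deriv_nonneg (convex_Icc p q)
    (fun t ht => (h t ht).continuousAt.continuousWithinAt)
    (fun t ht => (h t (interior_subset ht)).differentiableAt.differentiableWithinAt)
    (fun t ht => ?_) (left_mem_Icc.2 hpq) (right_mem_Icc.2 hpq) hpq
  rw [(h t (interior_subset ht)).deriv]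
  exact h0 t (interior_subset ht)

theorem lt_of_hasDerivAt_pos {f f' : ℝ → ℝ} {p q : ℝ} (hpq : p < q)
    (h : ∀ t ∈ Icc p q, HasDerivAt f (f' t) t) (h0 : ∀ t ∈ Ioo p q, 0 < f' t) : f p < f q := by
  refine strictMonoOn_of_deriv_pos (convex_Icc p q)
    (fun t ht => (h t ht).continuousAt.continuousWithinAt)
    (fun t ht => ?_) (left_mem_Icc.2 hpq.le) (right_mem_Icc.2 hpq.le) hpq
  rw [interior_Icc] at ht
  rw [(h t (Ioo_subset_Icc_self ht)).deriv]
  exact h0 t ht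

/-- The set on which the argument of `dF/dy` along the vertical segment from the real axis varies
by less than `3/2`. -/
def good (a : ℝ) : Set ℂ :=
  {z | 2 * (|z.re| * z.im ^ 2) < 3 * ((z.re ^ 2 + a ^ 2) * (z.re ^ 2 + a ^ 2 - z.im ^ 2))}

theorem isOpen_good (a : ℝ) : IsOpen (good a) :=
  isOpen_lt (by fun_prop) (by fun_prop)

theorem good_subset_dom {a : ℝ} (ha : 0 < a) : good a ⊆ dom a := by
  intro z hz
  have hz' : 2 * (|z.re| * z.im ^ 2) <
    3 * ((z.re ^ 2 + a ^ 2) * (z.re ^ 2 + a ^ 2 - z.im ^ 2)) := hz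
  change z.im ^ 2 < z.re ^ 2 + a ^ 2
  have h0 : 0 ≤ |z.re| * z.im ^ 2 := by positivity
  have hs : 0 < z.re ^ 2 + a ^ 2 := by positivity
  have := pos_of_mul_pos_right (a := z.re ^ 2 + a ^ 2) (b := z.re ^ 2 + a ^ 2 - z.im ^ 2)
    (by linarith) hs.le
  linarith

theorem good_of_sq_le {a x t y : ℝ} (h : (⟨x, y⟩ : ℂ) ∈ good a) (hty : t ^ 2 ≤ y ^ 2) :
    (⟨x, t⟩ : ℂ) ∈ good a := by
  have h' : 2 * (|x| * y ^ 2) < 3 * ((x ^ 2 + a ^ 2) * (x ^ 2 + a ^ 2 - y ^ 2)) := h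
  change 2 * (|x| * t ^ 2) < 3 * ((x ^ 2 + a ^ 2) * (x ^ 2 + a ^ 2 - t ^ 2))
  have h1 := mul_le_mul_of_nonneg_left hty (abs_nonneg x)
  have h2 : (x ^ 2 + a ^ 2) * t ^ 2 ≤ (x ^ 2 + a ^ 2) * y ^ 2 :=
    mul_le_mul_of_nonneg_left hty (by positivity)
  nlinarith

theorem good_mono {a x t y : ℝ} (h : (⟨x, y⟩ : ℂ) ∈ good a) (h0 : 0 ≤ t) (hty : t ≤ y) :
    (⟨x, t⟩ : ℂ) ∈ good a :=
  good_of_sq_le h (pow_le_pow_left₀ h0 hty 2)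

theorem hasDerivAt_mk (x t : ℝ) : HasDerivAt (fun t : ℝ => (⟨x, t⟩ : ℂ)) I t := by
  have : (fun t : ℝ => (⟨x, t⟩ : ℂ)) = fun t : ℝ => (x : ℂ) + (t : ℂ) * I := by
    ext t; exact mk_eq_add_mul_I x t
  rw [this]
  simpa using (((hasDerivAt_id t).ofReal_comp).mul_const I).const_add (x : ℂ)

theorem hasDerivAt_expo_mk {a : ℝ} (ha : 0 < a) {x t : ℝ} (h : (⟨x, t⟩ : ℂ) ∈ dom a) :
    HasDerivAt (fun t : ℝ => expo a ⟨x, t⟩) (I / ((⟨x, t⟩ : ℂ) ^ 2 + (a : ℂ) ^ 2)) t := by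
  have := (hasDerivAt_expo ha h).scomp t (hasDerivAt_mk x t)
  refine this.congr_deriv ?_
  rw [smul_eq_mul, mul_one_div]

theorem hasDerivAt_expo_re {a : ℝ} (ha : 0 < a) {x t : ℝ} (h : (⟨x, t⟩ : ℂ) ∈ dom a) :
    HasDerivAt (fun t : ℝ => (expo a ⟨x, t⟩).re)
      (2 * x * t / ((x ^ 2 + a ^ 2 - t ^ 2) ^ 2 + (2 * x * t) ^ 2)) t := by
  have := (reCLM.hasFDerivAt (x := expo a ⟨x, t⟩)).comp_hasDerivAt t (hasDerivAt_expo_mk ha h)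
  refine this.congr_deriv ?_
  rw [reCLM_apply, div_re, normSq_apply, sq_add_sq_re, sq_add_sq_im]
  simp only [I_re, I_im]
  ring

theorem hasDerivAt_expo_im {a : ℝ} (ha : 0 < a) {x t : ℝ} (h : (⟨x, t⟩ : ℂ) ∈ dom a) :
    HasDerivAt (fun t : ℝ => (expo a ⟨x, t⟩).im)
      ((x ^ 2 + a ^ 2 - t ^ 2) / ((x ^ 2 + a ^ 2 - t ^ 2) ^ 2 + (2 * x * t) ^ 2)) t := by
  have := (imCLM.hasFDerivAt (x := expo a ⟨x, t⟩)).comp_hasDerivAt t (hasDerivAt_expo_mk ha h)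
  refine this.congr_deriv ?_
  rw [imCLM_apply, div_im, normSq_apply, sq_add_sq_re, sq_add_sq_im]
  simp only [I_re, I_im]
  ring

theorem hasDerivAt_turned_mk {a : ℝ} (ha : 0 < a) {x t : ℝ} (h : (⟨x, t⟩ : ℂ) ∈ dom a) :
    HasDerivAt (fun t : ℝ => turned a ⟨x, t⟩)
      (Real.cosh (expo a ⟨x, t⟩).im * cexp ((expo a ⟨x, t⟩).re * I)) t := by
  have := (hasFDerivAt_turned ha h).comp_hasDerivAt t (hasDerivAt_mk x t)
  refine this.congr_deriv ?_
  rw [turnedDeriv_apply]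
  simp

theorem dom_mono {a x t y : ℝ} (h : (⟨x, y⟩ : ℂ) ∈ dom a) (h0 : 0 ≤ t) (hty : t ≤ y) :
    (⟨x, t⟩ : ℂ) ∈ dom a := by
  have h' : y ^ 2 < x ^ 2 + a ^ 2 := h
  change t ^ 2 < x ^ 2 + a ^ 2
  exact (pow_le_pow_left₀ h0 hty 2).trans_lt h'

theorem expo_mk_zero (a x : ℝ) : expo a ⟨x, 0⟩ = ((Real.arctan (x / a) / a : ℝ) : ℂ) :=
  expo_ofReal a x

theorem turned_mk_zero (a x : ℝ) : turned a ⟨x, 0⟩ = 0 := turned_ofReal a x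

/-- Dropping (2xt)² from the denominator of ∂u/∂t leaves a majorant which is exactly the
t-derivative of |x| / (x² + a² - t²). Comparing derivatives avoids integrals. -/
theorem abs_expo_re_sub_le {a : ℝ} (ha : 0 < a) {x t y : ℝ} (h : (⟨x, y⟩ : ℂ) ∈ dom a)
    (h0 : 0 ≤ t) (hty : t ≤ y) :
    |(expo a ⟨x, y⟩).re - (expo a ⟨x, t⟩).re| ≤
      |x| / (x ^ 2 + a ^ 2 - y ^ 2) - |x| / (x ^ 2 + a ^ 2 - t ^ 2) := by
  set s := x ^ 2 + a ^ 2 with hs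
  have hpos : ∀ τ ∈ Icc t y, 0 < s - τ ^ 2 := fun τ hτ => by
    have : τ ^ 2 < s := dom_mono h (h0.trans hτ.1) hτ.2
    linarith
  have hb : ∀ τ ∈ Icc t y, HasDerivAt (fun τ : ℝ => |x| / (s - τ ^ 2))
      (|x| * (2 * τ) / (s - τ ^ 2) ^ 2) τ := by
    intro τ hτ
    have h1 : HasDerivAt (fun τ : ℝ => s - τ ^ 2) (-(2 * τ)) τ := by
      simpa using (hasDerivAt_pow 2 τ).const_sub s
    refine ((hasDerivAt_const τ |x|).div h1 (hpos τ hτ).ne').congr_deriv ?_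
    ring
  have hu : ∀ τ ∈ Icc t y, _ := fun τ hτ =>
    hasDerivAt_expo_re ha (dom_mono h (h0.trans hτ.1) hτ.2)
  have hcmp : ∀ τ ∈ Icc t y, |2 * x * τ / ((s - τ ^ 2) ^ 2 + (2 * x * τ) ^ 2)| ≤
      |x| * (2 * τ) / (s - τ ^ 2) ^ 2 := by
    intro τ hτ
    have hp := hpos τ hτ
    have hτ0 : 0 ≤ τ := h0.trans hτ.1
    rw [abs_div, abs_of_nonneg (a := (s - τ ^ 2) ^ 2 + (2 * x * τ) ^ 2) (by positivity), abs_mul,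
      abs_mul, abs_two, abs_of_nonneg hτ0, show 2 * |x| * τ = |x| * (2 * τ) by ring]
    gcongr
    nlinarith [sq_nonneg (2 * x * τ)]
  have k1 := le_of_hasDerivAt_nonneg hty (fun τ hτ => (hb τ hτ).sub (hu τ hτ))
    (fun τ hτ => by have := (abs_le.1 (hcmp τ hτ)).2; linarith)
  have k2 := le_of_hasDerivAt_nonneg hty (fun τ hτ => (hb τ hτ).add (hu τ hτ))
    (fun τ hτ => by have := (abs_le.1 (hcmp τ hτ)).1; linarith)
  simp only [Pi.sub_apply, Pi.add_apply] at k1 k2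
  rw [abs_le]
  constructor <;> linarith

theorem abs_expo_re_sub_le_div {a : ℝ} (ha : 0 < a) {x t y : ℝ} (h : (⟨x, y⟩ : ℂ) ∈ dom a)
    (h0 : 0 ≤ t) (hty : t ≤ y) :
    |(expo a ⟨x, y⟩).re - (expo a ⟨x, t⟩).re| ≤
      |x| * y ^ 2 / ((x ^ 2 + a ^ 2) * (x ^ 2 + a ^ 2 - y ^ 2)) := by
  have hy : y ^ 2 < x ^ 2 + a ^ 2 := h
  have ht : t ^ 2 < x ^ 2 + a ^ 2 := dom_mono h h0 hty
  have hs : 0 < x ^ 2 + a ^ 2 := by positivity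
  refine (abs_expo_re_sub_le ha h h0 hty).trans ?_
  have e : |x| * y ^ 2 / ((x ^ 2 + a ^ 2) * (x ^ 2 + a ^ 2 - y ^ 2)) =
      |x| / (x ^ 2 + a ^ 2 - y ^ 2) - |x| / (x ^ 2 + a ^ 2) := by
    have : x ^ 2 + a ^ 2 - y ^ 2 ≠ 0 := by linarith
    field_simp
    ring
  rw [e]
  have : |x| / (x ^ 2 + a ^ 2) ≤ |x| / (x ^ 2 + a ^ 2 - t ^ 2) := by
    apply div_le_div_of_nonneg_left (abs_nonneg x) (by linarith)
    nlinarith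
  linarith

/-- The inequality defining `good` says exactly that the preceding bound is below 3/2, a rational
number less than π/2, so that cos(3/2) > 0. -/
theorem abs_expo_re_sub_lt {a : ℝ} (ha : 0 < a) {x t y : ℝ} (h : (⟨x, y⟩ : ℂ) ∈ good a)
    (h0 : 0 ≤ t) (hty : t ≤ y) :
    |(expo a ⟨x, y⟩).re - (expo a ⟨x, t⟩).re| < 3 / 2 := by
  refine (abs_expo_re_sub_le_div ha (good_subset_dom ha h) h0 hty).trans_lt ?_
  have hy : y ^ 2 < x ^ 2 + a ^ 2 := good_subset_dom ha h
  have hs : 0 < x ^ 2 + a ^ 2 := by positivity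
  have h' : 2 * (|x| * y ^ 2) < 3 * ((x ^ 2 + a ^ 2) * (x ^ 2 + a ^ 2 - y ^ 2)) := h
  rw [div_lt_iff₀ (mul_pos hs (by linarith))]
  linarith

theorem cos_three_halves_pos : 0 < Real.cos (3 / 2) :=
  Real.cos_pos_of_mem_Ioo ⟨by linarith [Real.pi_pos], by linarith [Real.pi_gt_d2]⟩

theorem cos_three_halves_le {ψ : ℝ} (h : |ψ| ≤ 3 / 2) : Real.cos (3 / 2) ≤ Real.cos ψ := by
  rw [← Real.cos_abs ψ]
  exact Real.cos_le_cos_of_nonneg_of_le_pi (abs_nonneg _) (by linarith [Real.pi_gt_d2]) h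

theorem mul_exp_re (c u α : ℝ) :
    ((c : ℂ) * cexp (u * I) * cexp (-α * I)).re = c * Real.cos (u - α) := by
  rw [mul_assoc, ← Complex.exp_add, show (u : ℂ) * I + -α * I = ((u - α : ℝ) : ℂ) * I by
    push_cast; ring, re_ofReal_mul, exp_ofReal_mul_I_re]

theorem mul_exp_im (c u α : ℝ) :
    ((c : ℂ) * cexp (u * I) * cexp (-α * I)).im = c * Real.sin (u - α) := by
  rw [mul_assoc, ← Complex.exp_add, show (u : ℂ) * I + -α * I = ((u - α : ℝ) : ℂ) * I by
    push_cast; ring, im_ofReal_mul, exp_ofReal_mul_I_im]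

theorem hasDerivAt_turned_rot_re {a : ℝ} (ha : 0 < a) {x t : ℝ} (h : (⟨x, t⟩ : ℂ) ∈ dom a)
    (α : ℝ) : HasDerivAt (fun t : ℝ => (turned a ⟨x, t⟩ * cexp (-α * I)).re)
      (Real.cosh (expo a ⟨x, t⟩).im * Real.cos ((expo a ⟨x, t⟩).re - α)) t := by
  have := (reCLM.hasFDerivAt (x := turned a ⟨x, t⟩ * cexp (-α * I))).comp_hasDerivAt t
    ((hasDerivAt_turned_mk ha h).mul_const (cexp (-α * I)))
  refine this.congr_deriv ?_
  rw [reCLM_apply, mul_exp_re]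

theorem hasDerivAt_turned_rot_im {a : ℝ} (ha : 0 < a) {x t : ℝ} (h : (⟨x, t⟩ : ℂ) ∈ dom a)
    (α : ℝ) : HasDerivAt (fun t : ℝ => (turned a ⟨x, t⟩ * cexp (-α * I)).im)
      (Real.cosh (expo a ⟨x, t⟩).im * Real.sin ((expo a ⟨x, t⟩).re - α)) t := by
  have := (imCLM.hasFDerivAt (x := turned a ⟨x, t⟩ * cexp (-α * I))).comp_hasDerivAt t
    ((hasDerivAt_turned_mk ha h).mul_const (cexp (-α * I)))
  refine this.congr_deriv ?_
  rw [imCLM_apply, mul_exp_im]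

/-- Comparison for the component of the slice curve in a direction from which its tangent deviates
by at most `3/2`. -/
theorem le_turned_rot_re {a : ℝ} (ha : 0 < a) {x y : ℝ} (h : (⟨x, y⟩ : ℂ) ∈ dom a) (hy : 0 ≤ y)
    {α : ℝ} (hα : ∀ t ∈ Icc 0 y, |(expo a ⟨x, t⟩).re - α| ≤ 3 / 2) {b b' : ℝ → ℝ} (hb0 : b 0 = 0)
    (hb : ∀ t ∈ Icc 0 y, HasDerivAt b (b' t) t)
    (hle : ∀ t ∈ Icc 0 y, b' t ≤ Real.cosh (expo a ⟨x, t⟩).im) :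
    Real.cos (3 / 2) * b y ≤ (turned a ⟨x, y⟩ * cexp (-α * I)).re := by
  have := le_of_hasDerivAt_nonneg hy (fun t ht =>
    (hasDerivAt_turned_rot_re ha (dom_mono h ht.1 ht.2) α).sub
      ((hb t ht).const_mul (Real.cos (3 / 2)))) (fun t ht => by
    have h1 := cos_three_halves_le (hα t ht)
    have h2 := mul_le_mul_of_nonneg_left (hle t ht) cos_three_halves_pos.le
    have h3 := mul_le_mul_of_nonneg_left h1 (Real.cosh_pos (expo a ⟨x, t⟩).im).le
    linarith)
  simp only [Pi.sub_apply, turned_mk_zero, hb0, zero_mul, zero_re, mul_zero] at this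
  linarith

theorem le_turned_rot_base_re {a : ℝ} (ha : 0 < a) {x y : ℝ} (h : (⟨x, y⟩ : ℂ) ∈ good a)
    (hy : 0 ≤ y) {b b' : ℝ → ℝ} (hb0 : b 0 = 0)
    (hb : ∀ t ∈ Icc 0 y, HasDerivAt b (b' t) t)
    (hle : ∀ t ∈ Icc 0 y, b' t ≤ Real.cosh (expo a ⟨x, t⟩).im) :
    Real.cos (3 / 2) * b y ≤
      (turned a ⟨x, y⟩ * cexp (-(Real.arctan (x / a) / a : ℝ) * I)).re := by
  refine le_turned_rot_re ha (good_subset_dom ha h) hy (fun t ht => ?_) hb0 hb hle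
  have := abs_expo_re_sub_lt ha (good_mono h ht.1 ht.2) le_rfl ht.1
  rw [expo_mk_zero, ofReal_re] at this
  exact this.le

theorem turned_rot_base_re {a : ℝ} (ha : 0 < a) {x y : ℝ} (h : (⟨x, y⟩ : ℂ) ∈ good a)
    (hy : 0 ≤ y) : Real.cos (3 / 2) * y ≤
      (turned a ⟨x, y⟩ * cexp (-(Real.arctan (x / a) / a : ℝ) * I)).re :=
  le_turned_rot_base_re ha h hy (b := id) rfl (fun t _ => hasDerivAt_id t)
    (fun _ _ => Real.one_le_cosh _)

/-- The reference direction is now the tangent at the endpoint, because this real part is what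
appears in the derivative of |T|². -/
theorem turned_rot_tip_re {a : ℝ} (ha : 0 < a) {x y : ℝ} (h : (⟨x, y⟩ : ℂ) ∈ good a)
    (hy : 0 ≤ y) : Real.cos (3 / 2) * y ≤
      (turned a ⟨x, y⟩ * cexp (-((expo a ⟨x, y⟩).re : ℝ) * I)).re :=
  le_turned_rot_re ha (good_subset_dom ha h) hy (b := id)
    (fun t ht => by rw [abs_sub_comm]; exact (abs_expo_re_sub_lt ha h ht.1 ht.2).le) rfl
    (fun t _ => hasDerivAt_id t) (fun _ _ => Real.one_le_cosh _)

theorem expo_im_pos {a : ℝ} (ha : 0 < a) {x y : ℝ} (h : (⟨x, y⟩ : ℂ) ∈ dom a) (hy : 0 < y) :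
    0 < (expo a ⟨x, y⟩).im := by
  have := lt_of_hasDerivAt_pos hy (fun t ht => hasDerivAt_expo_im ha (dom_mono h ht.1 ht.2))
    (fun t ht => by
      have : t ^ 2 < x ^ 2 + a ^ 2 := dom_mono h ht.1.le ht.2.le
      have : 0 < x ^ 2 + a ^ 2 - t ^ 2 := by linarith
      positivity)
  simpa [expo_mk_zero, -ofReal_div] using this

theorem hasDerivAt_normSq_turned {a : ℝ} (ha : 0 < a) {x t : ℝ} (h : (⟨x, t⟩ : ℂ) ∈ dom a) :
    HasDerivAt (fun t : ℝ => normSq (turned a ⟨x, t⟩))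
      (2 * (Real.cosh (expo a ⟨x, t⟩).im *
        (turned a ⟨x, t⟩ * cexp (-((expo a ⟨x, t⟩).re : ℝ) * I)).re)) t := by
  have hT := hasDerivAt_turned_mk ha h
  have hr := (reCLM.hasFDerivAt (x := turned a ⟨x, t⟩)).comp_hasDerivAt t hT
  have hi := (imCLM.hasFDerivAt (x := turned a ⟨x, t⟩)).comp_hasDerivAt t hT
  have := (hr.mul hr).add (hi.mul hi)
  have e : (fun t : ℝ => normSq (turned a ⟨x, t⟩)) =
      ((reCLM ∘ fun t : ℝ => turned a ⟨x, t⟩) * (reCLM ∘ fun t : ℝ => turned a ⟨x, t⟩)) +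
      ((imCLM ∘ fun t : ℝ => turned a ⟨x, t⟩) * (imCLM ∘ fun t : ℝ => turned a ⟨x, t⟩)) := by
    ext t; simp [normSq_apply]
  rw [e]
  refine this.congr_deriv ?_
  have e1 : cexp (-((expo a ⟨x, t⟩).re : ℝ) * I) =
      Real.cos (expo a ⟨x, t⟩).re - Real.sin (expo a ⟨x, t⟩).re * I := by
    rw [← ofReal_neg, exp_mul_I, ← ofReal_cos, ← ofReal_sin, Real.cos_neg, Real.sin_neg]
    push_cast; ring
  rw [e1, exp_mul_I, ← ofReal_cos, ← ofReal_sin]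
  simp [-ofReal_cosh, -ofReal_sin, -ofReal_cos]
  ring

/-- The position vector makes an acute angle with the current tangent (`turned_rot_tip_re`), so the
curve moves away from the axis at all times. -/
theorem normSq_turned_lt {a : ℝ} (ha : 0 < a) {x t y : ℝ} (h : (⟨x, y⟩ : ℂ) ∈ good a)
    (h0 : 0 ≤ t) (hty : t < y) : normSq (turned a ⟨x, t⟩) < normSq (turned a ⟨x, y⟩) := by
  refine lt_of_hasDerivAt_pos hty (fun τ hτ => hasDerivAt_normSq_turned ha
    (good_subset_dom ha (good_mono h (h0.trans hτ.1) hτ.2))) (fun τ hτ => ?_)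
  have hτ0 : 0 < τ := h0.trans_lt hτ.1
  have h1 := turned_rot_tip_re ha (good_mono h hτ0.le hτ.2.le) hτ0.le
  have h2 := lt_of_lt_of_le (mul_pos cos_three_halves_pos hτ0) h1
  have := Real.cosh_pos (expo a ⟨x, τ⟩).im
  positivity

/-! ### Symmetry under conjugation -/

/-- Conjugation inverts the quotient inside the logarithm. Since neither the quotient nor its
conjugate meets the cut, the principal logarithm respects both operations. -/
theorem expo_conj {a : ℝ} (ha : 0 < a) {z : ℂ} (hz : z ∈ dom a) :
    expo a (starRingEnd ℂ z) = starRingEnd ℂ (expo a z) := by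
  have hpos := one_add_div_sq_re_pos ha hz
  have hslit := one_add_mul_I_div_mem_slitPlane hpos
  set w := z / (a : ℂ) with hw
  have hc : starRingEnd ℂ z / (a : ℂ) = starRingEnd ℂ w := by simp [hw]
  have h1 : starRingEnd ℂ ((1 + w * I) / (1 - w * I)) =
      ((1 + starRingEnd ℂ w * I) / (1 - starRingEnd ℂ w * I))⁻¹ := by
    simp [sub_eq_add_neg]
  have h2 : (1 + starRingEnd ℂ w * I) / (1 - starRingEnd ℂ w * I) =
      (starRingEnd ℂ ((1 + w * I) / (1 - w * I)))⁻¹ := by rw [h1, inv_inv]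
  rw [mem_slitPlane_iff_arg] at hslit
  have h3 : (starRingEnd ℂ ((1 + w * I) / (1 - w * I))).arg ≠ Real.pi := by
    rw [arg_conj, if_neg hslit.1]
    intro h
    have := neg_pi_lt_arg ((1 + w * I) / (1 - w * I))
    linarith
  rw [expo, hc, Complex.arctan, h2, log_inv _ h3, log_conj _ hslit.1, expo, ← hw, Complex.arctan]
  simp only [map_mul, map_div₀, map_one, map_neg, conj_I, conj_ofReal,
    show starRingEnd ℂ (2 : ℂ) = 2 from map_ofNat _ 2]
  ring

/-- In t, u is even and v is odd, so the velocity cosh v · e^{iu} is even; a curve that starts at 0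
with even velocity is odd. -/
theorem turned_mk_neg {a : ℝ} (ha : 0 < a) {x y : ℝ} (h : (⟨x, y⟩ : ℂ) ∈ dom a) (hy : 0 ≤ y) :
    turned a ⟨x, -y⟩ = -turned a ⟨x, y⟩ := by
  have hd : ∀ t ∈ Icc 0 y, HasDerivAt (fun t : ℝ => turned a ⟨x, t⟩ + turned a ⟨x, -t⟩) 0 t := by
    intro t ht
    have h1 := dom_mono h ht.1 ht.2
    have h2 : (⟨x, -t⟩ : ℂ) ∈ dom a := by
      have : t ^ 2 < x ^ 2 + a ^ 2 := h1
      change (-t) ^ 2 < x ^ 2 + a ^ 2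
      linarith [neg_sq t]
    have h3 := (hasDerivAt_turned_mk ha h2).scomp t (hasDerivAt_neg t)
    have hm : (⟨x, -t⟩ : ℂ) = starRingEnd ℂ ⟨x, t⟩ := by apply Complex.ext <;> simp
    have e : expo a ⟨x, -t⟩ = starRingEnd ℂ (expo a ⟨x, t⟩) := by rw [hm, expo_conj ha h1]
    refine ((hasDerivAt_turned_mk ha h1).add h3).congr_deriv ?_
    rw [e, conj_re, conj_im, Real.cosh_neg, neg_one_smul, add_neg_cancel]
  have := constant_of_has_deriv_right_zero
    (fun t ht => (hd t ht).continuousAt.continuousWithinAt)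
    (fun t ht => (hd t (Ico_subset_Icc_self ht)).hasDerivWithinAt) y (right_mem_Icc.2 hy)
  simp only [neg_zero, turned_mk_zero, add_zero] at this
  exact eq_neg_of_add_eq_zero_right this

/-! ### Numerical estimates on the domain -/

theorem xA_bounds : 0.378 < xA ∧ xA < 0.3795 := by
  have h1 := Real.pi_gt_d2
  have h2 := Real.pi_lt_d2
  have h3 : 0.317 < 1 / Real.pi := by rw [lt_div_iff₀ Real.pi_pos]; linarith
  have h4 : 1 / Real.pi < 0.319 := by rw [div_lt_iff₀ Real.pi_pos]; linarith
  rw [xA]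
  constructor <;> linarith

theorem xB_bounds : 0.4389 < xB ∧ xB < 0.4397 := by
  have h1 := Real.pi_gt_d2
  have h2 := Real.pi_lt_d2
  have h3 : 0.317 < 1 / Real.pi := by rw [lt_div_iff₀ Real.pi_pos]; linarith
  have h4 : 1 / Real.pi < 0.319 := by rw [div_lt_iff₀ Real.pi_pos]; linarith
  rw [xB]
  constructor <;> linarith

theorem exists_fourth_root {s : ℝ} (hs : 0 < s) :
    ∃ q : ℝ, 0 < q ∧ s = q ^ 4 ∧ s ^ (3 / 4 : ℝ) = q ^ 3 ∧ s ^ (1 / 2 : ℝ) = q ^ 2 := by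
  refine ⟨s ^ (1 / 4 : ℝ), by positivity, ?_, ?_, ?_⟩
  · rw [← Real.rpow_mul_natCast hs.le]; norm_num
  · rw [← Real.rpow_mul_natCast hs.le]; norm_num
  · rw [← Real.rpow_mul_natCast hs.le]; norm_num

theorem yA_bounds {a : ℝ} (ha : 0 < a) (ha2 : a ≤ 1 / 2) :
    1 / 10 ≤ yA a ∧ yA a ^ 2 ≤ (xA ^ 2 + a ^ 2) / 4 := by
  obtain ⟨h1, h2⟩ := xA_bounds
  obtain ⟨q, hq, hs, h34, -⟩ := exists_fourth_root (s := xA ^ 2 + a ^ 2) (by positivity)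
  have hq1 : q ≤ 1 := by
    by_contra! h
    have : 1 < q ^ 4 := one_lt_pow₀ h (by norm_num)
    nlinarith
  rw [yA, h34, hs]
  constructor
  · by_contra! h
    -- 0.59³ > 0.2, so q³ < 0.2 would give q⁴ < 0.118, which is below 0.378² and hence below x_A² +
    -- a².
    have h3 : q < 0.59 := by
      by_contra! h'
      have := pow_le_pow_left₀ (by norm_num) h' 3
      norm_num at this
      linarith
    have : q ^ 4 < 0.2 * 0.59 := by
      have : q ^ 4 = q ^ 3 * q := by ring
      rw [this]
      have := pow_pos hq 3
      nlinarith
    nlinarith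
  · have : q ^ 6 ≤ q ^ 4 := pow_le_pow_of_le_one hq.le hq1 (by norm_num)
    nlinarith

theorem yB_bounds {a : ℝ} (ha : 0 < a) :
    1 / 10 ≤ yB a ∧ yB a ^ 2 = (xB ^ 2 + a ^ 2) / 4 := by
  obtain ⟨h1, h2⟩ := xB_bounds
  rw [yB, ← Real.sqrt_eq_rpow, div_pow, Real.sq_sqrt (by positivity)]
  constructor
  · have : (0.4 : ℝ) ≤ Real.sqrt (xB ^ 2 + a ^ 2) := by
      apply Real.le_sqrt_of_sq_le
      nlinarith
    linarith
  · norm_num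

/-- The three regimes of the half-height, with the estimates needed in the middle one. -/
theorem halfHeight_cases {a : ℝ} (ha : 0 < a) (ha2 : a ≤ 1 / 2) (x : ℝ) :
    (|x| ≤ xA ∧ halfHeight a x = (x ^ 2 + a ^ 2) ^ (3 / 4 : ℝ) / 2) ∨
    (xB ≤ |x| ∧ halfHeight a x = (x ^ 2 + a ^ 2) ^ (1 / 2 : ℝ) / 2) ∨
    (xA < |x| ∧ 1 / 10 ≤ halfHeight a x ∧ halfHeight a x ^ 2 ≤ (xB ^ 2 + a ^ 2) / 4) := by
  rw [halfHeight]
  split_ifs with h1 h2 h3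
  · exact Or.inl ⟨h1, rfl⟩
  · exact Or.inr (Or.inl ⟨h2, rfl⟩)
  all_goals
    refine Or.inr (Or.inr ⟨not_le.1 h1, ?_⟩)
    have hAB : 0 < xB - xA := by linarith [xA_bounds.2, xB_bounds.1]
    obtain ⟨hA1, hA2⟩ := yA_bounds ha ha2
    obtain ⟨hB1, hB2⟩ := yB_bounds ha
    obtain ⟨t, ht0, ht1, ht⟩ : ∃ t : ℝ, 0 ≤ t ∧ t ≤ 1 ∧ (|x| - xA) / (xB - xA) = t :=
      ⟨_, div_nonneg (by linarith) hAB.le, by rw [div_le_one hAB]; linarith, rfl⟩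
    have hAle : yA a ≤ yB a := by
      apply le_of_sq_le_sq ?_ (by linarith)
      nlinarith [xA_bounds.1, xB_bounds.1]
    first
    | rw [show (x - xA) / (xB - xA) = t by rw [← ht, abs_of_nonneg h3]]
    | rw [show (x + xA) / (xA - xB) = t by
        rw [← ht, abs_of_neg (not_le.1 h3), ← neg_div_neg_eq]; ring_nf]
    constructor
    · nlinarith
    · rw [← hB2]
      apply pow_le_pow_left₀ <;> nlinarith

/-- Put s = x² + a². In the inner zone s = q⁴ with q ≤ 1, |x| ≤ q² and y² ≤ q⁶/4, so the two sides
compare as q⁸/2 with at least 9q⁸/4. Elsewhere y² is at most a fixed fraction of s while |x| is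
bounded below. -/
theorem Omega_subset_good {a : ℝ} (ha : 0 < a) (ha2 : a ≤ 1 / 2) : Omega a ⊆ good a := by
  rintro ⟨x, y⟩ hz
  have hy : |y| ≤ halfHeight a x := hz
  have hy2 : y ^ 2 ≤ halfHeight a x ^ 2 := sq_le_sq' (by linarith [neg_abs_le y]) (by
    linarith [le_abs_self y])
  change 2 * (|x| * y ^ 2) < 3 * ((x ^ 2 + a ^ 2) * (x ^ 2 + a ^ 2 - y ^ 2))
  have hs0 : 0 < x ^ 2 + a ^ 2 := by positivity
  have hxs : |x| ^ 2 < x ^ 2 + a ^ 2 := by rw [sq_abs]; have := pow_pos ha 2; linarith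
  have hx0 := abs_nonneg x
  -- Rests on m|x| ≤ x² < s. It is used with k = 1/4 beyond x_B, and with k = 0.35 in the transition
  -- zone, where x_B²/4 ≤ 0.35 · 0.378².
  have far : ∀ k m : ℝ, 0 ≤ k → k < 1 → m ≤ |x| → 0 ≤ m → 2 * k ≤ 3 * m * (1 - k) →
      y ^ 2 ≤ k * (x ^ 2 + a ^ 2) →
      2 * (|x| * y ^ 2) < 3 * ((x ^ 2 + a ^ 2) * (x ^ 2 + a ^ 2 - y ^ 2)) := by
    intro k m hk hk1 hm hm0 hkm hyk
    set s := x ^ 2 + a ^ 2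
    calc 2 * (|x| * y ^ 2) ≤ 2 * (|x| * (k * s)) := by gcongr
      _ = 2 * k * (|x| * s) := by ring
      _ ≤ 3 * m * (1 - k) * (|x| * s) := by gcongr
      _ = 3 * (1 - k) * s * (m * |x|) := by ring
      _ ≤ 3 * (1 - k) * s * (|x| * |x|) := by
        have : 0 ≤ 1 - k := by linarith
        gcongr
      _ < 3 * (1 - k) * s * s := by
        have : 0 < 1 - k := by linarith
        have : 0 < 3 * (1 - k) * s := by positivity
        apply mul_lt_mul_of_pos_left _ this
        linarith [pow_two |x|]
      _ = 3 * (s * (s - k * s)) := by ring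
      _ ≤ 3 * (s * (s - y ^ 2)) := by gcongr
  rcases halfHeight_cases ha ha2 x with ⟨hx, he⟩ | ⟨hx, he⟩ | ⟨hx, -, he⟩
  · obtain ⟨q, hq, hs, h34, -⟩ := exists_fourth_root hs0
    rw [he, h34] at hy2
    have hxA : |x| ^ 2 ≤ 0.3795 ^ 2 := pow_le_pow_left₀ hx0 (hx.trans xA_bounds.2.le) 2
    rw [sq_abs] at hxA
    have hq1 : q ≤ 1 := by
      by_contra! h
      have : 1 < q ^ 4 := one_lt_pow₀ h (by norm_num)
      nlinarith
    have hxq : |x| ≤ q ^ 2 := by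
      apply le_of_sq_le_sq ?_ (by positivity)
      calc |x| ^ 2 ≤ q ^ 4 := by linarith
        _ = (q ^ 2) ^ 2 := by ring
    rw [hs]
    have h6 : y ^ 2 ≤ q ^ 6 / 4 := by rw [div_pow] at hy2; ring_nf at hy2 ⊢; linarith
    have h1 : |x| * y ^ 2 ≤ q ^ 2 * (q ^ 6 / 4) := by gcongr
    have h2 : q ^ 4 * (q ^ 4 - q ^ 6 / 4) ≤ q ^ 4 * (q ^ 4 - y ^ 2) := by gcongr
    have h3 : q ^ 10 ≤ q ^ 8 := pow_le_pow_of_le_one hq.le hq1 (by norm_num)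
    have h4 : 0 < q ^ 8 := by positivity
    nlinarith
  · rw [he, div_pow, ← Real.sqrt_eq_rpow, Real.sq_sqrt hs0.le] at hy2
    exact far (1 / 4) 0.4 (by norm_num) (by norm_num) (by linarith [xB_bounds.1]) (by norm_num)
      (by norm_num) (by linarith)
  · refine far 0.35 0.378 (by norm_num) (by norm_num) (by linarith [xA_bounds.1]) (by norm_num)
      (by norm_num) ?_
    have h1 : xB ^ 2 ≤ 0.4397 ^ 2 :=
      pow_le_pow_left₀ (by linarith [xB_bounds.1]) xB_bounds.2.le 2
    have h2 : 0.378 ^ 2 ≤ |x| ^ 2 := pow_le_pow_left₀ (by norm_num) (by linarith [xA_bounds.1]) 2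
    rw [sq_abs] at h2
    have := sq_nonneg a
    linarith

/-- Supplies a height at which the slice curve can be shown to be outside the cylinder. The cap 1/10
bounds the strip uniformly, which properness and the limits of the angle need; 4y² ≤ s is the range
of the lower bound for v. -/
theorem exists_height {a : ℝ} (ha : 0 < a) (ha2 : a ≤ 1 / 2) (x : ℝ) :
    ∃ y, 0 < y ∧ y ≤ 1 / 10 ∧ 4 * y ^ 2 ≤ x ^ 2 + a ^ 2 ∧ y ≤ halfHeight a x ∧
      (y = 1 / 10 ∨ ∃ q : ℝ, 0 < q ∧ q ≤ 1 ∧ x ^ 2 + a ^ 2 = q ^ 4 ∧ y = q ^ 3 / 2) := by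
  have hs0 : 0 < x ^ 2 + a ^ 2 := by positivity
  have tenth : xA < |x| → 1 / 10 ≤ halfHeight a x → ∃ y, 0 < y ∧ y ≤ 1 / 10 ∧
      4 * y ^ 2 ≤ x ^ 2 + a ^ 2 ∧ y ≤ halfHeight a x ∧
      (y = 1 / 10 ∨ ∃ q : ℝ, 0 < q ∧ q ≤ 1 ∧ x ^ 2 + a ^ 2 = q ^ 4 ∧ y = q ^ 3 / 2) := by
    intro hx h
    refine ⟨1 / 10, by norm_num, le_rfl, ?_, h, Or.inl rfl⟩
    have h2 : 0.378 ^ 2 ≤ |x| ^ 2 := pow_le_pow_left₀ (by norm_num) (by linarith [xA_bounds.1]) 2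
    rw [sq_abs] at h2
    have := sq_nonneg a
    linarith
  rcases halfHeight_cases ha ha2 x with ⟨hx, he⟩ | ⟨hx, he⟩ | ⟨hx, h, -⟩
  · obtain ⟨q, hq, hs, h34, -⟩ := exists_fourth_root hs0
    rw [h34] at he
    have hxA : |x| ^ 2 ≤ 0.3795 ^ 2 :=
      pow_le_pow_left₀ (abs_nonneg x) (hx.trans xA_bounds.2.le) 2
    rw [sq_abs] at hxA
    have hq1 : q ≤ 1 := by
      by_contra! h
      have : 1 < q ^ 4 := one_lt_pow₀ h (by norm_num)
      nlinarith
    by_cases h : q ^ 3 / 2 ≤ 1 / 10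
    · refine ⟨q ^ 3 / 2, by positivity, h, ?_, he.ge, Or.inr ⟨q, hq, hq1, hs, rfl⟩⟩
      rw [hs]
      have : q ^ 6 ≤ q ^ 4 := pow_le_pow_of_le_one hq.le hq1 (by norm_num)
      nlinarith
    · refine ⟨1 / 10, by norm_num, le_rfl, ?_, by rw [he]; linarith, Or.inl rfl⟩
      rw [hs]
      have h3 : 0.2 ≤ q := by
        have : q ^ 3 ≤ q ^ 1 := pow_le_pow_of_le_one hq.le hq1 (by norm_num)
        linarith
      have : q ^ 4 = q ^ 3 * q := by ring
      rw [this]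
      nlinarith
  · refine tenth (by linarith [xA_bounds.2, xB_bounds.1]) ?_
    rw [he, ← Real.sqrt_eq_rpow]
    have : (0.4 : ℝ) ≤ Real.sqrt (x ^ 2 + a ^ 2) := by
      apply Real.le_sqrt_of_sq_le
      have h2 : 0.4 ^ 2 ≤ |x| ^ 2 := pow_le_pow_left₀ (by norm_num) (by linarith [xB_bounds.1]) 2
      rw [sq_abs] at h2
      have := sq_nonneg a
      linarith
    linarith
  · exact tenth hx h

/-! ### A uniform exit radius -/

/-- With s = x² + a² and 4t² ≤ s, the numerator of ∂v/∂t is at least 3s/4 and its denominator at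
most (s + t²)² ≤ (5s/4)². The quotient is at least 12/(25s), and 2/5 < 12/25. -/
theorem le_expo_im {a : ℝ} (ha : 0 < a) {x y : ℝ} (h0 : 0 ≤ y) (hy : 4 * y ^ 2 ≤ x ^ 2 + a ^ 2) :
    2 / 5 * y / (x ^ 2 + a ^ 2) ≤ (expo a ⟨x, y⟩).im := by
  have hs : 0 < x ^ 2 + a ^ 2 := by positivity
  have hdom : (⟨x, y⟩ : ℂ) ∈ dom a := by
    change y ^ 2 < x ^ 2 + a ^ 2
    nlinarith
  have hb : ∀ t ∈ Icc 0 y, HasDerivAt (fun t : ℝ => 2 / 5 * t / (x ^ 2 + a ^ 2))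
      (2 / 5 / (x ^ 2 + a ^ 2)) t := fun t _ => by
    simpa using ((hasDerivAt_id t).const_mul (2 / 5)).div_const (x ^ 2 + a ^ 2)
  have := le_of_hasDerivAt_nonneg h0 (fun t ht =>
    (hasDerivAt_expo_im ha (dom_mono hdom ht.1 ht.2)).sub (hb t ht)) (fun t ht => by
      have ht2 : t ^ 2 ≤ y ^ 2 := pow_le_pow_left₀ ht.1 ht.2 2
      have hx : x ^ 2 ≤ x ^ 2 + a ^ 2 := by have := sq_nonneg a; linarith
      have hx' := mul_le_mul_of_nonneg_right hx (sq_nonneg t)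
      generalize x ^ 2 + a ^ 2 = s at *
      have hst : 0 < s - t ^ 2 := by nlinarith
      rw [sub_nonneg, div_le_div_iff₀ hs (by positivity)]
      have h3 : (s + t ^ 2) ^ 2 ≤ (5 / 4 * s) ^ 2 :=
        pow_le_pow_left₀ (by positivity) (by linarith) 2
      nlinarith)
  simp only [Pi.sub_apply, expo_mk_zero, ofReal_im, mul_zero, zero_div, sub_zero] at this
  linarith

/-- A fourth power suffices for the exit estimate: with y = s^{3/4}/2, the integral of (t/s)⁴ up to
y is a multiple of s^{-1/4}, which does not degenerate as s → 0. -/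
theorem pow_four_div_le_cosh {v : ℝ} (hv : 0 ≤ v) : v ^ 4 / 48 ≤ Real.cosh v := by
  have := Real.pow_div_factorial_le_exp v hv 4
  rw [Real.cosh_eq]
  have h2 := Real.exp_pos (-v)
  norm_num [Nat.factorial] at this
  linarith

/-- The radius of the cylinder. -/
noncomputable def radius : ℝ := Real.cos (3 / 2) / 10 ^ 6

theorem radius_pos : 0 < radius := div_pos cos_three_halves_pos (by norm_num)

theorem norm_mul_exp (T : ℂ) (α : ℝ) : ‖T * cexp (-(α : ℝ) * I)‖ = ‖T‖ := by
  rw [norm_mul, ← ofReal_neg, norm_exp_ofReal_mul_I, mul_one]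

theorem exists_exit {a : ℝ} (ha : 0 < a) (ha2 : a ≤ 1 / 2) (x : ℝ) :
    ∃ y, 0 < y ∧ y ≤ 1 / 10 ∧ (⟨x, y⟩ : ℂ) ∈ Omega a ∧ radius < ‖turned a ⟨x, y⟩‖ := by
  obtain ⟨y, hy0, hy1, hy4, hyH, hy⟩ := exists_height ha ha2 x
  have hO : (⟨x, y⟩ : ℂ) ∈ Omega a := by
    change |y| ≤ halfHeight a x
    rwa [abs_of_pos hy0]
  refine ⟨y, hy0, hy1, hO, ?_⟩
  have hg := Omega_subset_good ha ha2 hO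
  rw [← norm_mul_exp _ (Real.arctan (x / a) / a)]
  refine lt_of_lt_of_le ?_ (re_le_norm _)
  have hcos := cos_three_halves_pos
  rcases hy with rfl | ⟨q, hq, hq1, hs, rfl⟩
  · refine lt_of_lt_of_le ?_ (turned_rot_base_re ha hg hy0.le)
    rw [radius]
    linarith
  -- `k` combines the bound v ≥ (2/5)t/q⁴ with cosh v ≥ v⁴/48. Integrating up to q³/2 gives k/(160q)
  -- ≥ k/160 > 10⁻⁶, which explains the 10⁶ in `radius`.
  · set y := q ^ 3 / 2 with hy
    set k : ℝ := (2 / 5) ^ 4 / 48 with hk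
    have hb : ∀ t ∈ Icc 0 y, HasDerivAt (fun t : ℝ => k / 5 / q ^ 16 * t ^ 5)
        (k / q ^ 16 * t ^ 4) t := fun t _ => by
      refine ((hasDerivAt_pow 5 t).const_mul (k / 5 / q ^ 16)).congr_deriv ?_
      push_cast
      ring
    have := le_turned_rot_base_re ha hg hy0.le (by simp) hb (fun t ht => by
      have ht4 : 4 * t ^ 2 ≤ x ^ 2 + a ^ 2 := by
        have := pow_le_pow_left₀ ht.1 ht.2 2
        linarith
      have hv := le_expo_im ha ht.1 ht4
      have hpos : 0 ≤ 2 / 5 * t / (x ^ 2 + a ^ 2) := by have := ht.1; positivity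
      refine le_trans ?_ (pow_four_div_le_cosh (hpos.trans hv))
      refine le_trans (le_of_eq ?_) (div_le_div_of_nonneg_right (pow_le_pow_left₀ hpos hv 4)
        (by norm_num))
      rw [hs, hk]
      field_simp)
    refine lt_of_lt_of_le ?_ this
    have e : k / 5 / q ^ 16 * y ^ 5 = k / 160 / q := by
      rw [hy]; field_simp; norm_num
    rw [e, radius, div_eq_mul_inv]
    refine mul_lt_mul_of_pos_left ?_ hcos
    rw [lt_div_iff₀ hq, hk]
    refine lt_of_le_of_lt (mul_le_mul_of_nonneg_left hq1 (by norm_num)) ?_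
    norm_num

/-! ### Smooth dependence of the exit height -/

/-- A left inverse of a smooth map whose differential is everywhere injective is smooth on the
(open) image. -/
theorem contDiffOn_leftInverse {f g : ℂ → ℂ} {V : Set ℂ} (hV : IsOpen V)
    (hf : ContDiffOn ℝ ∞ f V) (hg : ∀ z ∈ V, g (f z) = z)
    (hd : ∀ z ∈ V, ∀ w, fderiv ℝ f z w = 0 → w = 0) :
    IsOpen (f '' V) ∧ ContDiffOn ℝ ∞ g (f '' V) := by
  have hmain : ∀ z ∈ V, f '' V ∈ nhds (f z) ∧ ContDiffAt ℝ ∞ g (f z) := by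
    intro z hz
    have hcd : ContDiffAt ℝ ∞ f z := hf.contDiffAt (hV.mem_nhds hz)
    have hinj : Function.Injective (fderiv ℝ f z : ℂ →ₗ[ℝ] ℂ) := by
      rw [← LinearMap.ker_eq_bot, LinearMap.ker_eq_bot']
      exact hd z hz
    let f' : ℂ ≃L[ℝ] ℂ := (LinearEquiv.ofInjectiveEndo _ hinj).toContinuousLinearEquiv
    have hf' : HasFDerivAt f (f' : ℂ →L[ℝ] ℂ) z := by
      have : (f' : ℂ →L[ℝ] ℂ) = fderiv ℝ f z := by ext w; rfl
      rw [this]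
      exact (hcd.differentiableAt (by simp)).hasFDerivAt
    have hn : (∞ : WithTop ℕ∞) ≠ 0 := by simp
    let e := hcd.toOpenPartialHomeomorph f hf' hn
    have hsrc : z ∈ e.source := hcd.mem_toOpenPartialHomeomorph_source hf' hn
    have htgt : e.target ∈ nhds (f z) := e.open_target.mem_nhds (e.map_source hsrc)
    have hloc : ContDiffAt ℝ ∞ e.symm (f z) := hcd.to_localInverse hf' hn
    have hz' : e.symm (f z) = z := e.left_inv hsrc
    have hVn : ∀ᶠ w in nhds (f z), e.symm w ∈ V :=
      hloc.continuousAt.eventually (by rw [hz']; exact hV.mem_nhds hz)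
    -- Wherever the local inverse takes values in `V`, the identity g ∘ f = id forces `g` to agree
    -- with it, so `g` inherits its smoothness.
    have hright : ∀ᶠ w in nhds (f z), e.symm w ∈ V ∧ f (e.symm w) = w := by
      filter_upwards [hVn, htgt] with w hw hwt
      exact ⟨hw, e.right_inv hwt⟩
    refine ⟨?_, hloc.congr_of_eventuallyEq ?_⟩
    · filter_upwards [hright] with w hw using ⟨_, hw.1, hw.2⟩
    · filter_upwards [hright] with w hw
      rw [← hg _ hw.1, hw.2]
  refine ⟨isOpen_iff_mem_nhds.2 ?_, ?_⟩
  · rintro _ ⟨z, hz, rfl⟩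
    exact (hmain z hz).1
  · rintro _ ⟨z, hz, rfl⟩
    exact (hmain z hz).2.contDiffWithinAt

theorem contDiffOn_of_hasDerivAt {f f' : ℂ → ℂ} {U : Set ℂ} (hU : IsOpen U)
    (h : ∀ z ∈ U, HasDerivAt f (f' z) z) : ContDiffOn ℝ ∞ f U :=
  (DifferentiableOn.contDiffOn (fun z hz => (h z hz).differentiableAt.differentiableWithinAt)
    hU).restrict_scalars ℝ

theorem contDiffOn_turned {a : ℝ} (ha : 0 < a) : ContDiffOn ℝ ∞ (turned a) (dom a) := by
  have h1 := contDiffOn_of_hasDerivAt (isOpen_dom a) (fun z hz => hasDerivAt_primS ha hz)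
  have h2 := contDiffOn_of_hasDerivAt (isOpen_dom a) (fun z hz => hasDerivAt_primC ha hz)
  have k1 := ofRealCLM.contDiff.comp_contDiffOn (reCLM.contDiff.comp_contDiffOn h1)
  have k2 := ofRealCLM.contDiff.comp_contDiffOn (reCLM.contDiff.comp_contDiffOn h2)
  exact (contDiffOn_const.mul k1).sub k2

/-- The upper half of `good`. -/
def upper (a : ℝ) : Set ℂ := {z | z ∈ good a ∧ 0 < z.im}

theorem isOpen_upper (a : ℝ) : IsOpen (upper a) :=
  (isOpen_good a).inter (isOpen_lt continuous_const continuous_im)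

theorem upper_subset_dom {a : ℝ} (ha : 0 < a) : upper a ⊆ dom a :=
  fun _ hz => good_subset_dom ha hz.1

theorem norm_turned_lt {a : ℝ} (ha : 0 < a) {x t y : ℝ} (h : (⟨x, y⟩ : ℂ) ∈ good a)
    (h0 : 0 ≤ t) (hty : t < y) : ‖turned a ⟨x, t⟩‖ < ‖turned a ⟨x, y⟩‖ := by
  have := normSq_turned_lt ha h h0 hty
  rw [normSq_eq_norm_sq, normSq_eq_norm_sq] at this
  exact lt_of_pow_lt_pow_left₀ 2 (norm_nonneg _) this

theorem norm_turned_lt_iff {a : ℝ} (ha : 0 < a) {x t y : ℝ} (ht : (⟨x, t⟩ : ℂ) ∈ good a)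
    (hy : (⟨x, y⟩ : ℂ) ∈ good a) (h0 : 0 ≤ t) (hy0 : 0 ≤ y) :
    ‖turned a ⟨x, t⟩‖ < ‖turned a ⟨x, y⟩‖ ↔ t < y := by
  refine ⟨fun h => ?_, norm_turned_lt ha hy h0⟩
  by_contra! h'
  rcases h'.eq_or_lt with rfl | h'
  · exact lt_irrefl _ h
  · exact lt_asymm h (norm_turned_lt ha ht hy0 h')

/-- The map whose first component is the abscissa and whose second component is the squared
distance from the axis. -/
noncomputable def sliceMap (a : ℝ) (z : ℂ) : ℂ := ⟨z.re, normSq (turned a z)⟩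

theorem injOn_sliceMap {a : ℝ} (ha : 0 < a) : InjOn (sliceMap a) (upper a) := by
  rintro ⟨x, y⟩ hz ⟨x', y'⟩ hz' h
  obtain ⟨rfl, h2⟩ : x = x' ∧ normSq (turned a ⟨x, y⟩) = normSq (turned a ⟨x', y'⟩) :=
    ⟨congrArg re h, congrArg im h⟩
  rcases lt_trichotomy y y' with h | rfl | h
  · exact absurd h2 (normSq_turned_lt ha hz'.1 (le_of_lt hz.2) h).ne
  · rfl
  · exact absurd h2 (normSq_turned_lt ha hz.1 (le_of_lt hz'.2) h).ne'

theorem contDiffOn_sliceMap {a : ℝ} (ha : 0 < a) : ContDiffOn ℝ ∞ (sliceMap a) (upper a) := by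
  have hT := (contDiffOn_turned ha).mono (upper_subset_dom ha)
  have hr := reCLM.contDiff.comp_contDiffOn hT
  have hi := imCLM.contDiff.comp_contDiffOn hT
  have hN := ofRealCLM.contDiff.comp_contDiffOn ((hr.mul hr).add (hi.mul hi))
  have hx : ContDiff ℝ ∞ (fun z : ℂ => (z.re : ℂ)) := ofRealCLM.contDiff.comp reCLM.contDiff
  refine (hx.contDiffOn.add (hN.mul (contDiffOn_const (c := I)))).congr fun z _ => ?_
  rw [sliceMap, mk_eq_add_mul_I, normSq_apply]
  simp

/-- The Jacobian is triangular with diagonal entries 1 and ∂|T|²/∂y, and the latter is positive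
above the real axis. -/
theorem fderiv_sliceMap_ker {a : ℝ} (ha : 0 < a) {z : ℂ} (hz : z ∈ upper a) (w : ℂ)
    (hw : fderiv ℝ (sliceMap a) z w = 0) : w = 0 := by
  have hd : HasFDerivAt (sliceMap a) (fderiv ℝ (sliceMap a) z) z :=
    (((contDiffOn_sliceMap ha).contDiffAt ((isOpen_upper a).mem_nhds hz)).differentiableAt
      (by simp)).hasFDerivAt
  have hre : w.re = 0 := by
    have h1 := reCLM.hasFDerivAt.comp z hd
    have h2 : HasFDerivAt (reCLM ∘ sliceMap a) reCLM z := reCLM.hasFDerivAt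
    have := congrArg (fun L : ℂ →L[ℝ] ℝ => L w) (h1.unique h2)
    simpa [hw] using this.symm
  have hw' : w = (w.im : ℝ) • I := by
    apply Complex.ext <;> simp [hre]
  have h1 := (imCLM.hasFDerivAt.comp z hd).comp_hasDerivAt z.im (hasDerivAt_mk z.re z.im)
  have h2 := hasDerivAt_normSq_turned ha (upper_subset_dom ha hz)
  have h3 := h1.unique h2
  have hpos := lt_of_lt_of_le (mul_pos cos_three_halves_pos hz.2)
    (turned_rot_tip_re ha hz.1 (le_of_lt hz.2))
  have h4 : w.im * (fderiv ℝ (sliceMap a) z I).im = 0 := by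
    rw [hw', map_smul] at hw
    have := congrArg im hw
    simpa using this
  have hc := Real.cosh_pos (expo a z).im
  have h5 : (fderiv ℝ (sliceMap a) z I).im ≠ 0 := by
    have h6 : (fderiv ℝ (sliceMap a) z I).im = _ := h3
    rw [h6]
    exact (mul_pos two_pos (mul_pos hc hpos)).ne'
  apply Complex.ext
  · exact hre
  · simpa [h5] using h4

/-- The height at which the slice curve over the abscissa `x` reaches distance `r` from the
axis. -/
noncomputable def height (a r x : ℝ) : ℝ :=
  (Function.invFunOn (sliceMap a) (upper a) ⟨x, r ^ 2⟩).im

/-- Intermediate value theorem: along the segment |T|² runs from 0 to a value above radius². This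
ensures that the inverse in `height` takes a genuine value for every r in (0, radius]. -/
theorem mem_image_sliceMap {a r : ℝ} (ha : 0 < a) (ha2 : a ≤ 1 / 2) (hr : 0 < r)
    (hr2 : r ≤ radius) (x : ℝ) : (⟨x, r ^ 2⟩ : ℂ) ∈ sliceMap a '' upper a := by
  obtain ⟨y, hy0, -, hyO, hy⟩ := exists_exit ha ha2 x
  have hg := Omega_subset_good ha ha2 hyO
  have hcont : ContinuousOn (fun t : ℝ => normSq (turned a ⟨x, t⟩)) (Icc 0 y) := fun t ht =>
    (hasDerivAt_normSq_turned ha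
      (good_subset_dom ha (good_mono hg ht.1 ht.2))).continuousAt.continuousWithinAt
  have hmem : r ^ 2 ∈ Ioo (normSq (turned a ⟨x, 0⟩)) (normSq (turned a ⟨x, y⟩)) := by
    constructor
    · rw [turned_mk_zero, map_zero]; positivity
    · rw [normSq_eq_norm_sq]
      exact pow_lt_pow_left₀ (hr2.trans_lt hy) hr.le two_ne_zero
  obtain ⟨t, ht, hte⟩ := intermediate_value_Ioo hy0.le hcont hmem
  exact ⟨⟨x, t⟩, ⟨good_mono hg ht.1.le ht.2.le, ht.1⟩, Complex.ext rfl hte⟩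

theorem height_spec {a r : ℝ} (ha : 0 < a) (ha2 : a ≤ 1 / 2) (hr : 0 < r) (hr2 : r ≤ radius)
    (x : ℝ) : (⟨x, height a r x⟩ : ℂ) ∈ upper a ∧ ‖turned a ⟨x, height a r x⟩‖ = r := by
  have h := mem_image_sliceMap ha ha2 hr hr2 x
  have h1 := Function.invFunOn_mem h
  have h2 := Function.invFunOn_eq h
  have h3 : (Function.invFunOn (sliceMap a) (upper a) ⟨x, r ^ 2⟩).re = x := congrArg re h2
  have h4 : normSq (turned a (Function.invFunOn (sliceMap a) (upper a) ⟨x, r ^ 2⟩)) = r ^ 2 :=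
    congrArg im h2
  have h5 : (⟨x, height a r x⟩ : ℂ) = Function.invFunOn (sliceMap a) (upper a) ⟨x, r ^ 2⟩ :=
    Complex.ext h3.symm rfl
  rw [h5]
  refine ⟨h1, ?_⟩
  rw [normSq_eq_norm_sq] at h4
  exact (pow_left_inj₀ (norm_nonneg _) hr.le two_ne_zero).1 h4

theorem height_unique {a r : ℝ} (ha : 0 < a) {z : ℂ} (hz : z ∈ upper a)
    (h : ‖turned a z‖ = r) : z = ⟨z.re, height a r z.re⟩ := by
  have h1 : sliceMap a z = ⟨z.re, r ^ 2⟩ := by rw [sliceMap, normSq_eq_norm_sq, h]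
  refine Complex.ext (by rfl) ?_
  simp only [height]
  rw [← h1, (injOn_sliceMap ha).leftInvOn_invFunOn hz]

theorem contDiff_height {a r : ℝ} (ha : 0 < a) (ha2 : a ≤ 1 / 2) (hr : 0 < r)
    (hr2 : r ≤ radius) : ContDiff ℝ ∞ (height a r) := by
  obtain ⟨-, h2⟩ := contDiffOn_leftInverse (isOpen_upper a) (contDiffOn_sliceMap ha)
    (fun z hz => (injOn_sliceMap ha).leftInvOn_invFunOn hz)
    (fun z hz => fderiv_sliceMap_ker ha hz)
  have hc : ContDiff ℝ ∞ (fun x : ℝ => (⟨x, r ^ 2⟩ : ℂ)) := by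
    have : (fun x : ℝ => (⟨x, r ^ 2⟩ : ℂ)) = fun x : ℝ => (x : ℂ) + ((r ^ 2 : ℝ) : ℂ) * I := by
      ext x; exact mk_eq_add_mul_I _ _
    rw [this]
    exact ofRealCLM.contDiff.add contDiff_const
  exact contDiffOn_univ.1 (imCLM.contDiff.comp_contDiffOn
    (h2.comp hc.contDiffOn (fun x _ => mem_image_sliceMap ha ha2 hr hr2 x)))

theorem norm_turned_lt_radius_iff {a r : ℝ} (ha : 0 < a) (ha2 : a ≤ 1 / 2) (hr : 0 < r)
    (hr2 : r ≤ radius) {x y : ℝ} (h : (⟨x, y⟩ : ℂ) ∈ good a) (hy : 0 ≤ y) :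
    ‖turned a ⟨x, y⟩‖ < r ↔ y < height a r x := by
  obtain ⟨h1, h2⟩ := height_spec ha ha2 hr hr2 x
  rw [← norm_turned_lt_iff ha h h1.1 hy (le_of_lt h1.2), h2]

theorem norm_turned_le_radius_iff {a r : ℝ} (ha : 0 < a) (ha2 : a ≤ 1 / 2) (hr : 0 < r)
    (hr2 : r ≤ radius) {x y : ℝ} (h : (⟨x, y⟩ : ℂ) ∈ good a) (hy : 0 ≤ y) :
    ‖turned a ⟨x, y⟩‖ ≤ r ↔ y ≤ height a r x := by
  obtain ⟨h1, h2⟩ := height_spec ha ha2 hr hr2 x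
  rw [← not_lt, ← not_lt, ← norm_turned_lt_iff ha h1.1 h (le_of_lt h1.2) hy, h2]

theorem height_bounds {a r : ℝ} (ha : 0 < a) (ha2 : a ≤ 1 / 2) (hr : 0 < r) (hr2 : r ≤ radius)
    (x : ℝ) : height a r x < 1 / 10 ∧ height a r x < halfHeight a x := by
  obtain ⟨h1, h2⟩ := height_spec ha ha2 hr hr2 x
  obtain ⟨y, hy0, hy1, hyO, hy⟩ := exists_exit ha ha2 x
  have hlt := (norm_turned_lt_iff ha h1.1 (Omega_subset_good ha ha2 hyO) (le_of_lt h1.2) hy0.le).1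
    (by rw [h2]; exact hr2.trans_lt hy)
  have hyO' : |y| ≤ halfHeight a x := hyO
  rw [abs_of_pos hy0] at hyO'
  exact ⟨by linarith, by linarith⟩

/-! ### The logarithm of the projection and the angle on level curves -/

/-- A logarithm of `turned`, whose imaginary part is close to `arctan (x / a) / a`. -/
noncomputable def logTurned (a : ℝ) (z : ℂ) : ℂ :=
  Complex.log (turned a z * cexp (-(Real.arctan (z.re / a) / a : ℝ) * I)) +
    (Real.arctan (z.re / a) / a : ℝ) * I

/-- Turning T back by its initial direction puts it in the right half plane, where the principal
logarithm is smooth; this makes `logTurned` a smooth branch on all of `upper a`. -/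
theorem turned_rot_re_pos {a : ℝ} (ha : 0 < a) {z : ℂ} (hz : z ∈ upper a) :
    0 < (turned a z * cexp (-(Real.arctan (z.re / a) / a : ℝ) * I)).re :=
  lt_of_lt_of_le (mul_pos cos_three_halves_pos hz.2) (turned_rot_base_re ha hz.1 (le_of_lt hz.2))

theorem turned_ne_zero {a : ℝ} (ha : 0 < a) {z : ℂ} (hz : z ∈ upper a) : turned a z ≠ 0 := by
  intro h
  have := turned_rot_re_pos ha hz
  simp [h] at this

theorem exp_logTurned {a : ℝ} (ha : 0 < a) {z : ℂ} (hz : z ∈ upper a) :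
    cexp (logTurned a z) = turned a z := by
  rw [logTurned, Complex.exp_add, Complex.exp_log
    (mul_ne_zero (turned_ne_zero ha hz) (exp_ne_zero _)), mul_assoc, ← Complex.exp_add]
  simp

theorem logTurned_re {a : ℝ} (z : ℂ) : (logTurned a z).re = Real.log ‖turned a z‖ := by
  rw [logTurned, add_re, log_re, norm_mul_exp, re_ofReal_mul]
  simp

theorem logTurned_im {a : ℝ} (z : ℂ) : (logTurned a z).im =
    (turned a z * cexp (-(Real.arctan (z.re / a) / a : ℝ) * I)).arg +
      Real.arctan (z.re / a) / a := by
  rw [logTurned, add_im, log_im, im_ofReal_mul, I_im, mul_one]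

theorem contDiffOn_logTurned {a : ℝ} (ha : 0 < a) :
    ContDiffOn ℝ ∞ (logTurned a) (upper a) := by
  have hT := (contDiffOn_turned ha).mono (upper_subset_dom ha)
  have hb : ContDiff ℝ ∞ (fun z : ℂ => ((Real.arctan (z.re / a) / a : ℝ) : ℂ)) := by
    refine ofRealCLM.contDiff.comp ?_
    have : ContDiff ℝ ∞ (fun z : ℂ => z.re / a) := reCLM.contDiff.div_const a
    exact (Real.contDiff_arctan.comp this).div_const a
  have he : ContDiff ℝ ∞ (fun z : ℂ => cexp (-(Real.arctan (z.re / a) / a : ℝ) * I)) :=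
    Complex.contDiff_exp.comp (hb.neg.mul contDiff_const)
  have hp := hT.mul he.contDiffOn
  refine ContDiffOn.add (fun z hz => ?_) (hb.mul contDiff_const).contDiffOn
  have hlog : ContDiffAt ℝ ∞ Complex.log
      (turned a z * cexp (-(Real.arctan (z.re / a) / a : ℝ) * I)) :=
    (Complex.contDiffAt_log (Or.inl (turned_rot_re_pos ha hz))).restrict_scalars ℝ
  exact hlog.comp_contDiffWithinAt z (hp z hz)

theorem hasFDerivAt_logTurned {a : ℝ} (ha : 0 < a) {z : ℂ} (hz : z ∈ upper a) :
    HasFDerivAt (logTurned a) (fderiv ℝ (logTurned a) z) z :=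
  (((contDiffOn_logTurned ha).contDiffAt ((isOpen_upper a).mem_nhds hz)).differentiableAt
    (by simp)).hasFDerivAt

theorem turned_mul_fderiv_logTurned {a : ℝ} (ha : 0 < a) {z : ℂ} (hz : z ∈ upper a) (w : ℂ) :
    turned a z * fderiv ℝ (logTurned a) z w = turnedDeriv a z w := by
  have h1 := ((Complex.hasDerivAt_exp (logTurned a z)).hasFDerivAt.restrictScalars ℝ).comp z
    (hasFDerivAt_logTurned ha hz)
  have h2 := hasFDerivAt_turned ha (upper_subset_dom ha hz)
  have h3 : cexp ∘ logTurned a =ᶠ[nhds z] turned a := by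
    filter_upwards [(isOpen_upper a).mem_nhds hz] with w hw using exp_logTurned ha hw
  have := congrArg (fun L : ℂ →L[ℝ] ℂ => L w) (h1.unique (h2.congr_of_eventuallyEq h3))
  simpa [exp_logTurned ha hz, mul_comm] using this

/-- T_x and T_y are orthogonal with lengths |sinh v| and cosh v, and v > 0 above the real axis, so
the differential of T is invertible there. -/
theorem fderiv_logTurned_ker {a : ℝ} (ha : 0 < a) {z : ℂ} (hz : z ∈ upper a) (w : ℂ)
    (hw : fderiv ℝ (logTurned a) z w = 0) : w = 0 := by
  have h := turned_mul_fderiv_logTurned ha hz w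
  rw [hw, mul_zero, turnedDeriv_apply] at h
  have h2 := (mul_eq_zero.1 h.symm).resolve_right (exp_ne_zero _)
  have hv : 0 < (expo a z).im := expo_im_pos ha (upper_subset_dom ha hz) hz.2
  have hc := Real.cosh_pos (expo a z).im
  have hs : 0 < Real.sinh (expo a z).im := Real.sinh_pos_iff.2 hv
  have r1 := congrArg re h2
  have r2 := congrArg im h2
  simp [-ofReal_sinh, -ofReal_cosh] at r1 r2
  exact Complex.ext (r2.resolve_right hv.ne') (r1.resolve_right hc.ne')

open Filter Topology

/-- The polar angle (up to a quarter turn) along the curve at distance `r` from the axis. -/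
noncomputable def angle (a r x : ℝ) : ℝ := (logTurned a ⟨x, height a r x⟩).im

theorem hasDerivAt_angle {a r : ℝ} (ha : 0 < a) (ha2 : a ≤ 1 / 2) (hr : 0 < r)
    (hr2 : r ≤ radius) (x : ℝ) : ∃ d, 0 < d ∧ HasDerivAt (angle a r) d x := by
  obtain ⟨hz, -⟩ := height_spec ha ha2 hr hr2 x
  set z : ℂ := ⟨x, height a r x⟩ with hzdef
  have hh : HasDerivAt (height a r) (deriv (height a r) x) x :=
    ((contDiff_height ha ha2 hr hr2).differentiable (by simp) x).hasDerivAt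
  set m := deriv (height a r) x
  have hc : HasDerivAt (fun x : ℝ => (⟨x, height a r x⟩ : ℂ)) (1 + m * I) x := by
    have : (fun x : ℝ => (⟨x, height a r x⟩ : ℂ)) =
        fun x : ℝ => (x : ℂ) + (height a r x : ℂ) * I := by
      ext x; exact mk_eq_add_mul_I _ _
    rw [this]
    exact ((hasDerivAt_id x).ofReal_comp).add (hh.ofReal_comp.mul_const I)
  have hl := (hasFDerivAt_logTurned ha hz).comp_hasDerivAt x hc
  set d := fderiv ℝ (logTurned a) z (1 + m * I)
  have hre : d.re = 0 := by
    have h1 := (reCLM.hasFDerivAt (x := logTurned a z)).comp_hasDerivAt x hl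
    have h2 : (reCLM ∘ (logTurned a ∘ fun x : ℝ => (⟨x, height a r x⟩ : ℂ))) =
        fun _ => Real.log r := by
      ext t
      simp only [Function.comp, reCLM_apply, logTurned_re, (height_spec ha ha2 hr hr2 t).2]
    rw [h2] at h1
    exact h1.unique (hasDerivAt_const x _)
  have him := (imCLM.hasFDerivAt (x := logTurned a z)).comp_hasDerivAt x hl
  have hv : 0 < (expo a z).im := expo_im_pos ha (upper_subset_dom ha hz) hz.2
  have hs : 0 < Real.sinh (expo a z).im := Real.sinh_pos_iff.2 hv
  have hτ := lt_of_lt_of_le (mul_pos cos_three_halves_pos hz.2)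
    (turned_rot_tip_re ha hz.1 (le_of_lt hz.2))
  -- On a level curve of |T| the derivative of log T is purely imaginary, say i·d'. The imaginary
  -- part of this identity then reads Re(T e^{-iu}) · d' = sinh v; both known factors are positive,
  -- hence d' > 0, and the slope m drops out.
  have key : turned a z * cexp (-((expo a z).re : ℝ) * I) * d =
      I * Real.sinh (expo a z).im + m * Real.cosh (expo a z).im := by
    have h1 := turned_mul_fderiv_logTurned ha hz (1 + m * I)
    rw [turnedDeriv_apply] at h1
    have h2 : cexp ((expo a z).re * I) * cexp (-((expo a z).re : ℝ) * I) = 1 := by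
      rw [← Complex.exp_add]; simp
    have h3 : ((1 + m * I : ℂ).re : ℂ) = 1 := by simp
    have h4 : ((1 + m * I : ℂ).im : ℂ) = m := by simp
    rw [h3, h4] at h1
    linear_combination cexp (-((expo a z).re : ℝ) * I) * h1 +
      (I * Real.sinh (expo a z).im + m * Real.cosh (expo a z).im) * h2
  have key' := congrArg im key
  rw [mul_im, hre, mul_zero, add_comm, zero_add] at key'
  simp only [add_im, im_ofReal_mul, ofReal_im, mul_zero, add_zero, I_mul_im, ofReal_re] at key'
  refine ⟨d.im, ?_, him⟩
  change (turned a z * cexp (-((expo a z).re : ℝ) * I)).re * d.im = _ at key'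
  exact pos_of_mul_pos_right (by rw [key']; exact hs) hτ.le

theorem strictMono_angle {a r : ℝ} (ha : 0 < a) (ha2 : a ≤ 1 / 2) (hr : 0 < r)
    (hr2 : r ≤ radius) : StrictMono (angle a r) := by
  refine strictMono_of_deriv_pos fun x => ?_
  obtain ⟨d, hd, h⟩ := hasDerivAt_angle ha ha2 hr hr2 x
  rwa [h.deriv]

theorem continuous_angle {a r : ℝ} (ha : 0 < a) (ha2 : a ≤ 1 / 2) (hr : 0 < r)
    (hr2 : r ≤ radius) : Continuous (angle a r) := by
  refine continuous_iff_continuousAt.2 fun x => ?_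
  obtain ⟨d, -, h⟩ := hasDerivAt_angle ha ha2 hr hr2 x
  exact h.continuousAt

theorem abs_arg_le_of_abs_im_le {w : ℂ} {c : ℝ} (hre : 0 < w.re) (h : |w.im| ≤ c * w.re) :
    |w.arg| ≤ c := by
  have h1 : |w.arg| < Real.pi / 2 := abs_arg_lt_pi_div_two_iff.2 (Or.inl hre)
  have h2 : |w.arg| ≤ |Real.tan w.arg| := by
    have := Real.le_tan (abs_nonneg _) h1
    rcases abs_choice w.arg with h | h
    · rw [h] at this ⊢; exact this.trans (le_abs_self _)
    · rw [h, Real.tan_neg] at this; rw [h]; exact this.trans (neg_le_abs _)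
  refine h2.trans ?_
  rw [tan_arg, abs_div, abs_of_pos hre, div_le_iff₀ hre]
  exact h

theorem abs_angle_sub_le {a r : ℝ} (ha : 0 < a) (ha2 : a ≤ 1 / 2) (hr : 0 < r)
    (hr2 : r ≤ radius) {x : ℝ} (hx : 1 ≤ |x|) :
    |angle a r x - Real.arctan (x / a) / a| ≤ 1 / Real.cos (3 / 2) / |x| := by
  obtain ⟨hz, -⟩ := height_spec ha ha2 hr hr2 x
  have hy1 := (height_bounds ha ha2 hr hr2 x).1
  rw [angle, logTurned_im, add_sub_cancel_right]
  have hpos := turned_rot_re_pos ha hz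
  refine abs_arg_le_of_abs_im_le hpos ?_
  simp only at hpos ⊢
  set y := height a r x
  set β := Real.arctan (x / a) / a with hβ
  have hy0 : 0 < y := hz.2
  have hdom := upper_subset_dom ha hz
  have hκ := cos_three_halves_pos
  have hx0 : 0 < |x| := by linarith
  -- For |x| ≥ 1 the bounded height y < 1/10 makes the tangent deviate from its initial direction by
  -- O(1/|x|). The chord T then deviates by O(1/|x|) as well, which yields the limits of the angle.
  have hang : ∀ t ∈ Icc 0 y, |(expo a ⟨x, t⟩).re - β| ≤ 1 / |x| := by
    intro t ht
    have h1 := abs_expo_re_sub_le_div ha (dom_mono hdom ht.1 ht.2) le_rfl ht.1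
    rw [expo_mk_zero, ofReal_re] at h1
    refine h1.trans ?_
    have ht2 : t ^ 2 ≤ (1 / 10) ^ 2 := pow_le_pow_left₀ ht.1 (ht.2.trans hy1.le) 2
    have hs1 : |x| ^ 2 ≤ x ^ 2 + a ^ 2 := by rw [sq_abs]; have := sq_nonneg a; linarith
    have hs2 : 1 ≤ |x| ^ 2 := one_le_pow₀ hx
    have hst : t ^ 2 ≤ x ^ 2 + a ^ 2 - t ^ 2 := by linarith
    have hst0 : 0 < x ^ 2 + a ^ 2 - t ^ 2 := by linarith
    rw [div_le_div_iff₀ (mul_pos (by linarith) hst0) hx0]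
    calc |x| * t ^ 2 * |x| = |x| ^ 2 * t ^ 2 := by ring
      _ ≤ (x ^ 2 + a ^ 2) * (x ^ 2 + a ^ 2 - t ^ 2) := by gcongr
      _ = _ := by ring
  have hang2 : ∀ t ∈ Icc 0 y, |(expo a ⟨x, t⟩).re - β| ≤ 3 / 2 := fun t ht =>
    (hang t ht).trans (by rw [div_le_iff₀ hx0]; linarith)
  have hpt : ∀ t ∈ Icc 0 y, |Real.sin ((expo a ⟨x, t⟩).re - β)| ≤
      1 / Real.cos (3 / 2) / |x| * Real.cos ((expo a ⟨x, t⟩).re - β) := by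
    intro t ht
    refine Real.abs_sin_le_abs.trans ((hang t ht).trans ?_)
    have := cos_three_halves_le (hang2 t ht)
    calc 1 / |x| = 1 / Real.cos (3 / 2) / |x| * Real.cos (3 / 2) := by field_simp
      _ ≤ _ := by gcongr
  set c := 1 / Real.cos (3 / 2) / |x|
  have hR : ∀ t ∈ Icc 0 y, _ := fun t ht =>
    (hasDerivAt_turned_rot_re ha (dom_mono hdom ht.1 ht.2) β).const_mul c
  have hI : ∀ t ∈ Icc 0 y, _ := fun t ht =>
    hasDerivAt_turned_rot_im ha (dom_mono hdom ht.1 ht.2) β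
  have k1 := le_of_hasDerivAt_nonneg hy0.le (fun t ht => (hR t ht).sub (hI t ht)) (fun t ht => by
    have h1 := (abs_le.1 (hpt t ht)).2
    have := mul_le_mul_of_nonneg_left h1 (Real.cosh_pos (expo a ⟨x, t⟩).im).le
    linarith)
  have k2 := le_of_hasDerivAt_nonneg hy0.le (fun t ht => (hR t ht).add (hI t ht)) (fun t ht => by
    have h1 := (abs_le.1 (hpt t ht)).1
    have := mul_le_mul_of_nonneg_left h1 (Real.cosh_pos (expo a ⟨x, t⟩).im).le
    linarith)
  simp only [Pi.sub_apply, Pi.add_apply, turned_mk_zero, zero_mul, zero_re, zero_im, mul_zero,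
    sub_zero, add_zero] at k1 k2
  rw [abs_le]
  constructor <;> linarith

theorem tendsto_angle_sub {a r : ℝ} (ha : 0 < a) (ha2 : a ≤ 1 / 2) (hr : 0 < r)
    (hr2 : r ≤ radius) {l : Filter ℝ} (hl : Tendsto (fun x : ℝ => |x|) l atTop) :
    Tendsto (fun x => angle a r x - Real.arctan (x / a) / a) l (𝓝 0) := by
  refine squeeze_zero_norm' ?_ (hl.const_div_atTop (1 / Real.cos (3 / 2)))
  filter_upwards [hl.eventually_ge_atTop 1] with x hx
  exact abs_angle_sub_le ha ha2 hr hr2 hx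

theorem tendsto_angle_atTop {a r : ℝ} (ha : 0 < a) (ha2 : a ≤ 1 / 2) (hr : 0 < r)
    (hr2 : r ≤ radius) : Tendsto (angle a r) atTop (𝓝 (Real.pi / 2 / a)) := by
  have h1 := tendsto_angle_sub ha ha2 hr hr2 tendsto_abs_atTop_atTop
  have h2 : Tendsto (fun x : ℝ => Real.arctan (x / a) / a) atTop (𝓝 (Real.pi / 2 / a)) :=
    ((Real.tendsto_arctan_atTop.mono_right nhdsWithin_le_nhds).comp
      (tendsto_id.atTop_div_const ha)).div_const a
  simpa using h1.add h2

theorem tendsto_angle_atBot {a r : ℝ} (ha : 0 < a) (ha2 : a ≤ 1 / 2) (hr : 0 < r)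
    (hr2 : r ≤ radius) : Tendsto (angle a r) atBot (𝓝 (-(Real.pi / 2 / a))) := by
  have h1 := tendsto_angle_sub ha ha2 hr hr2 tendsto_abs_atBot_atTop
  have h2 : Tendsto (fun x : ℝ => Real.arctan (x / a) / a) atBot (𝓝 (-(Real.pi / 2) / a)) :=
    ((Real.tendsto_arctan_atBot.mono_right nhdsWithin_le_nhds).comp
      (tendsto_id.atBot_div_const ha)).div_const a
  simpa [neg_div] using h1.add h2

theorem range_angle {a r : ℝ} (ha : 0 < a) (ha2 : a ≤ 1 / 2) (hr : 0 < r)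
    (hr2 : r ≤ radius) :
    range (angle a r) = Ioo (-(Real.pi / 2 / a)) (Real.pi / 2 / a) := by
  have hm := strictMono_angle ha ha2 hr hr2
  have ht := tendsto_angle_atTop ha ha2 hr hr2
  have hb := tendsto_angle_atBot ha ha2 hr hr2
  ext θ
  constructor
  · rintro ⟨x, rfl⟩
    exact ⟨(hm.monotone.le_of_tendsto hb (x - 1)).trans_lt (hm (by linarith)),
      (hm (by linarith)).trans_le (hm.monotone.ge_of_tendsto ht (x + 1))⟩
  · rintro ⟨h1, h2⟩
    exact mem_range_of_exists_le_of_exists_ge (continuous_angle ha ha2 hr hr2)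
      ((hb.eventually (eventually_lt_nhds h1)).exists.imp fun _ h => le_of_lt h)
      ((ht.eventually (eventually_gt_nhds h2)).exists.imp fun _ h => le_of_lt h)

/-! ### The two multi-valued graphs -/

/-- The part of the upper half of `good` that is mapped into the open cylinder. -/
def core (a : ℝ) : Set ℂ := {z | z ∈ upper a ∧ ‖turned a z‖ < radius}

theorem core_subset_upper (a : ℝ) : core a ⊆ upper a := fun _ hz => hz.1

theorem isOpen_core {a : ℝ} (ha : 0 < a) : IsOpen (core a) := by
  have hc : ContinuousOn (fun z => ‖turned a z‖) (upper a) :=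
    ((contDiffOn_turned ha).mono (upper_subset_dom ha)).continuousOn.norm
  exact hc.isOpen_inter_preimage (isOpen_upper a) isOpen_Iio

theorem logTurned_eq {a : ℝ} (ha : 0 < a) {z : ℂ} (hz : z ∈ upper a) :
    logTurned a z = ⟨Real.log ‖turned a z‖, angle a ‖turned a z‖ z.re⟩ := by
  apply Complex.ext
  · exact logTurned_re z
  · change (logTurned a z).im = (logTurned a ⟨z.re, height a ‖turned a z‖ z.re⟩).im
    rw [← height_unique ha hz rfl]

theorem injOn_logTurned {a : ℝ} (ha : 0 < a) (ha2 : a ≤ 1 / 2) :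
    InjOn (logTurned a) (core a) := by
  intro z hz z' hz' h
  have hn : ‖turned a z‖ = ‖turned a z'‖ := by
    rw [← exp_logTurned ha hz.1, ← exp_logTurned ha hz'.1, h]
  have h' := h
  rw [logTurned_eq ha hz.1, logTurned_eq ha hz'.1, hn] at h'
  have h3 := ((Complex.mk.injEq _ _ _ _).mp h').2
  have hx : z.re = z'.re := (strictMono_angle ha ha2
    (norm_pos_iff.2 (turned_ne_zero ha hz'.1)) (le_of_lt hz'.2)).injective h3
  calc z = ⟨z.re, height a ‖turned a z'‖ z.re⟩ := height_unique ha hz.1 hn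
    _ = ⟨z'.re, height a ‖turned a z'‖ z'.re⟩ := by rw [hx]
    _ = z' := (height_unique ha hz'.1 rfl).symm

theorem image_logTurned {a : ℝ} (ha : 0 < a) (ha2 : a ≤ 1 / 2) :
    logTurned a '' core a = {ζ | Real.exp ζ.re < radius ∧
      ζ.im ∈ Ioo (-(Real.pi / 2 / a)) (Real.pi / 2 / a)} := by
  ext ζ
  constructor
  · rintro ⟨z, hz, rfl⟩
    have hpos := norm_pos_iff.2 (turned_ne_zero ha hz.1)
    constructor
    · rw [logTurned_re, Real.exp_log hpos]; exact hz.2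
    · rw [← range_angle ha ha2 hpos (le_of_lt hz.2), logTurned_eq ha hz.1]
      exact ⟨_, rfl⟩
  · rintro ⟨h1, h2⟩
    have hpos := Real.exp_pos ζ.re
    rw [← range_angle ha ha2 hpos h1.le] at h2
    obtain ⟨x, hx⟩ := h2
    obtain ⟨hz, hn⟩ := height_spec ha ha2 hpos h1.le x
    refine ⟨_, ⟨hz, by rwa [hn]⟩, ?_⟩
    rw [logTurned_eq ha hz, hn, Real.log_exp]
    exact Complex.ext rfl hx

theorem Fmap_eq_turned (a : ℝ) (z : ℂ) :
    Fmap a z = !₂[(turned a z).im, -(turned a z).re, z.re] := by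
  rw [Fmap_eq, turned]
  simp

theorem Fmap_sq_add_sq (a : ℝ) (z : ℂ) : Fmap a z 0 ^ 2 + Fmap a z 1 ^ 2 = ‖turned a z‖ ^ 2 := by
  rw [Fmap_eq_turned, ← normSq_eq_norm_sq, normSq_apply]
  simp
  ring

theorem Fmap_mem_cylinder_iff {a : ℝ} (z : ℂ) :
    Fmap a z ∈ cylinder radius ↔ ‖turned a z‖ ≤ radius := by
  change Fmap a z 0 ^ 2 + Fmap a z 1 ^ 2 ≤ radius ^ 2 ↔ _
  rw [Fmap_sq_add_sq, pow_le_pow_iff_left₀ (norm_nonneg _) radius_pos.le two_ne_zero]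

theorem Fmap_mem_puncturedCylinder_iff {a : ℝ} (z : ℂ) :
    Fmap a z ∈ puncturedCylinder radius ↔ turned a z ≠ 0 ∧ ‖turned a z‖ < radius := by
  change (0 < Fmap a z 0 ^ 2 + Fmap a z 1 ^ 2 ∧ Fmap a z 0 ^ 2 + Fmap a z 1 ^ 2 < radius ^ 2) ↔ _
  rw [Fmap_sq_add_sq, pow_lt_pow_iff_left₀ (norm_nonneg _) radius_pos.le two_ne_zero,
    sq_pos_iff, norm_ne_zero_iff]

theorem turned_conj {a : ℝ} (ha : 0 < a) {z : ℂ} (hz : z ∈ dom a) (hy : 0 ≤ z.im) :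
    turned a (starRingEnd ℂ z) = -turned a z :=
  turned_mk_neg ha hz hy

theorem norm_turned_abs_im {a : ℝ} (ha : 0 < a) {z : ℂ} (hz : z ∈ dom a) :
    ‖turned a ⟨z.re, |z.im|⟩‖ = ‖turned a z‖ := by
  rcases le_total 0 z.im with h | h
  · rw [abs_of_nonneg h]
  · rw [abs_of_nonpos h]
    have h1 : (⟨z.re, -z.im⟩ : ℂ) ∈ dom a := by
      have hz' : z.im ^ 2 < z.re ^ 2 + a ^ 2 := hz
      change (-z.im) ^ 2 < z.re ^ 2 + a ^ 2
      rwa [neg_sq]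
    have := turned_mk_neg ha h1 (by linarith)
    rw [neg_neg] at this
    rw [← norm_neg, ← this]

theorem good_abs_im {a : ℝ} {z : ℂ} (hz : z ∈ good a) : (⟨z.re, |z.im|⟩ : ℂ) ∈ good a :=
  good_of_sq_le hz (sq_abs _).le

/-- The part of `Omega` that is mapped into the closed cylinder lies between two smooth graphs. -/
theorem Omega_inter_preimage {a : ℝ} (ha : 0 < a) (ha2 : a ≤ 1 / 2) :
    Omega a ∩ Fmap a ⁻¹' cylinder radius = {z | |z.im| ≤ height a radius z.re} := by
  ext z
  constructor
  · rintro ⟨hO, hC⟩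
    have hg := Omega_subset_good ha ha2 hO
    have hn := (Fmap_mem_cylinder_iff z).1 hC
    rw [← norm_turned_abs_im ha (good_subset_dom ha hg)] at hn
    exact (norm_turned_le_radius_iff ha ha2 radius_pos le_rfl (good_abs_im hg)
      (abs_nonneg _)).1 hn
  · intro h
    have h' : |z.im| ≤ height a radius z.re := h
    have hO : z ∈ Omega a := h'.trans (height_bounds ha ha2 radius_pos le_rfl z.re).2.le
    have hg := Omega_subset_good ha ha2 hO
    refine ⟨hO, (Fmap_mem_cylinder_iff z).2 ?_⟩
    rw [← norm_turned_abs_im ha (good_subset_dom ha hg)]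
    exact (norm_turned_le_radius_iff ha ha2 radius_pos le_rfl (good_abs_im hg)
      (abs_nonneg _)).2 h'

/-- A surface with the polar description given by `logTurned`, up to a rotation about the axis, is
a multi-valued graph. -/
theorem isMultivaluedGraph_image {a : ℝ} (ha : 0 < a) (ha2 : a ≤ 1 / 2) {X : ℂ → E3} (δ : ℝ)
    (hX : ∀ z ∈ core a, X z = !₂[‖turned a z‖ * Real.cos ((logTurned a z).im + δ),
      ‖turned a z‖ * Real.sin ((logTurned a z).im + δ), z.re]) :
    IsMultivaluedGraph radius (X '' core a) := by
  obtain ⟨-, hg⟩ := contDiffOn_leftInverse (isOpen_core ha)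
    ((contDiffOn_logTurned ha).mono (core_subset_upper a))
    (fun z hz => (injOn_logTurned ha ha2).leftInvOn_invFunOn hz)
    (fun z hz => fderiv_logTurned_ker ha hz.1)
  have hinv := (injOn_logTurned ha ha2).leftInvOn_invFunOn
  set g := Function.invFunOn (logTurned a) (core a)
  have himg : ∀ q ∈ Ioo 0 radius ×ˢ Ioo (-(Real.pi / 2 / a) + δ) (Real.pi / 2 / a + δ),
      (⟨Real.log q.1, q.2 - δ⟩ : ℂ) ∈ logTurned a '' core a := by
    rintro ⟨ρ, θ⟩ ⟨hρ, hθ⟩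
    rw [image_logTurned ha ha2]
    refine ⟨?_, ?_, ?_⟩
    · change Real.exp (Real.log ρ) < radius
      rw [Real.exp_log hρ.1]; exact hρ.2
    · have := hθ.1; change _ < θ - δ; linarith
    · have := hθ.2; change θ - δ < _; linarith
  refine ⟨-(Real.pi / 2 / a) + δ, Real.pi / 2 / a + δ, ?_,
    fun q => (g ⟨Real.log q.1, q.2 - δ⟩).re, ?_, ?_⟩
  -- The total angle is π/a, and a ≤ 1/2 makes it at least a full turn.
  · have : Real.pi / 2 / a = Real.pi / (2 * a) := by rw [div_div]
    have h2 : Real.pi ≤ Real.pi / (2 * a) := by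
      rw [le_div_iff₀ (by linarith)]
      nlinarith [Real.pi_pos]
    linarith
  · refine reCLM.contDiff.comp_contDiffOn (hg.comp (fun q hq => ?_) himg)
    have h1 : ContDiffAt ℝ ∞ (fun q : ℝ × ℝ => Real.log q.1) q :=
      contDiffAt_fst.log hq.1.1.ne'
    have h2 : ContDiffAt ℝ ∞ (fun q : ℝ × ℝ => q.2 - δ) q := contDiffAt_snd.sub contDiffAt_const
    have h3 := ((ofRealCLM.contDiff.contDiffAt.comp q h1).add
      ((ofRealCLM.contDiff.contDiffAt.comp q h2).mul (contDiffAt_const (c := I))))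
    refine (h3.congr_of_eventuallyEq (Eventually.of_forall fun p => ?_)).contDiffWithinAt
    exact mk_eq_add_mul_I _ _
  · apply Subset.antisymm
    · rintro _ ⟨z, hz, rfl⟩
      have hpos := norm_pos_iff.2 (turned_ne_zero ha hz.1)
      have hmem : logTurned a z ∈ logTurned a '' core a := ⟨z, hz, rfl⟩
      rw [image_logTurned ha ha2] at hmem
      refine ⟨(‖turned a z‖, (logTurned a z).im + δ),
        ⟨⟨hpos, hz.2⟩, by linarith [hmem.2.1], by linarith [hmem.2.2]⟩, ?_⟩
      have e : (⟨Real.log ‖turned a z‖, (logTurned a z).im + δ - δ⟩ : ℂ) = logTurned a z := by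
        rw [add_sub_cancel_right, ← logTurned_re]
      rw [hX z hz]
      simp only [e, hinv hz]
    · rintro _ ⟨⟨ρ, θ⟩, hq, rfl⟩
      obtain ⟨z, hz, he⟩ := himg _ hq
      have hρ : ‖turned a z‖ = ρ := by
        rw [← exp_logTurned ha hz.1, he, norm_exp]
        exact Real.exp_log hq.1.1
      refine ⟨z, hz, ?_⟩
      have e : (logTurned a z).im + δ = θ := by rw [he]; simp
      rw [hX z hz, hρ, e]
      simp only [← he, hinv hz]

theorem turned_polar {a : ℝ} (ha : 0 < a) {z : ℂ} (hz : z ∈ upper a) :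
    (turned a z).re = ‖turned a z‖ * Real.cos (logTurned a z).im ∧
    (turned a z).im = ‖turned a z‖ * Real.sin (logTurned a z).im := by
  have h := exp_logTurned ha hz
  rw [← h, norm_exp]
  exact ⟨exp_re _, exp_im _⟩

/-- The shift by -π/2 undoes the factor i in T = i(x₁ + i x₂). On the lower half T changes sign, so
there the shift is π/2. -/
theorem isMultivaluedGraph_upper {a : ℝ} (ha : 0 < a) (ha2 : a ≤ 1 / 2) :
    IsMultivaluedGraph radius (Fmap a '' core a) := by
  refine isMultivaluedGraph_image ha ha2 (-(Real.pi / 2)) fun z hz => ?_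
  obtain ⟨h1, h2⟩ := turned_polar ha hz.1
  rw [Fmap_eq_turned, ← sub_eq_add_neg, Real.cos_sub_pi_div_two, Real.sin_sub_pi_div_two,
    mul_neg, ← h1, ← h2]

theorem isMultivaluedGraph_lower {a : ℝ} (ha : 0 < a) (ha2 : a ≤ 1 / 2) :
    IsMultivaluedGraph radius ((fun z => Fmap a (starRingEnd ℂ z)) '' core a) := by
  refine isMultivaluedGraph_image ha ha2 (Real.pi / 2) fun z hz => ?_
  obtain ⟨h1, h2⟩ := turned_polar ha hz.1
  rw [Fmap_eq_turned, turned_conj ha (upper_subset_dom ha hz.1) (le_of_lt hz.1.2),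
    Real.cos_add_pi_div_two, Real.sin_add_pi_div_two, mul_neg, ← h1, ← h2]
  simp

/-- `core` is cut out of `good`, which contains Ω_a; the slice curves reach the radius below the
half-height, so nothing outside Ω_a is picked up. -/
theorem core_subset_Omega {a : ℝ} (ha : 0 < a) (ha2 : a ≤ 1 / 2) : core a ⊆ Omega a := by
  intro z hz
  have h := (norm_turned_lt_radius_iff ha ha2 radius_pos le_rfl hz.1.1 (le_of_lt hz.1.2)).1 hz.2
  change |z.im| ≤ halfHeight a z.re
  rw [abs_of_pos hz.1.2]
  exact (h.trans (height_bounds ha ha2 radius_pos le_rfl z.re).2).le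

theorem conj_mem_Omega_iff {a : ℝ} (z : ℂ) : starRingEnd ℂ z ∈ Omega a ↔ z ∈ Omega a := by
  change |(starRingEnd ℂ z).im| ≤ halfHeight a (starRingEnd ℂ z).re ↔ |z.im| ≤ halfHeight a z.re
  rw [conj_im, conj_re, abs_neg]

theorem puncturedCylinder_inter_Sigma {a : ℝ} (ha : 0 < a) (ha2 : a ≤ 1 / 2) :
    puncturedCylinder radius ∩ Sigma a =
      Fmap a '' core a ∪ (fun z => Fmap a (starRingEnd ℂ z)) '' core a := by
  apply Subset.antisymm
  · rintro _ ⟨hp, z, hz, rfl⟩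
    obtain ⟨h0, h1⟩ := (Fmap_mem_puncturedCylinder_iff z).1 hp
    rcases lt_trichotomy z.im 0 with h | h | h
    · right
      have hc := (conj_mem_Omega_iff (a := a) z).2 hz
      have hg := Omega_subset_good ha ha2 hc
      have hpos : 0 < (starRingEnd ℂ z).im := by rw [conj_im]; linarith
      have ht := turned_conj ha (good_subset_dom ha hg) hpos.le
      rw [conj_conj] at ht
      refine ⟨starRingEnd ℂ z, ⟨⟨hg, hpos⟩, ?_⟩, by simp only [conj_conj]⟩
      rwa [← norm_neg, ← ht]
    · have e : z = (z.re : ℂ) := Complex.ext (by simp) (by simp [h])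
      rw [e, turned_ofReal] at h0
      exact absurd rfl h0
    · exact Or.inl ⟨z, ⟨⟨Omega_subset_good ha ha2 hz, h⟩, h1⟩, rfl⟩
  · rintro p (⟨z, hz, rfl⟩ | ⟨z, hz, rfl⟩)
    · exact ⟨(Fmap_mem_puncturedCylinder_iff z).2 ⟨turned_ne_zero ha hz.1, hz.2⟩,
        z, core_subset_Omega ha ha2 hz, rfl⟩
    · refine ⟨(Fmap_mem_puncturedCylinder_iff _).2 ?_, _,
        (conj_mem_Omega_iff z).2 (core_subset_Omega ha ha2 hz), rfl⟩
      rw [turned_conj ha (upper_subset_dom ha hz.1) (le_of_lt hz.1.2), norm_neg, neg_ne_zero]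
      exact ⟨turned_ne_zero ha hz.1, hz.2⟩

theorem Fmap_eq_iff {a : ℝ} {z z' : ℂ} :
    Fmap a z = Fmap a z' ↔ turned a z = turned a z' ∧ z.re = z'.re := by
  constructor
  · intro h
    rw [Fmap_eq_turned, Fmap_eq_turned] at h
    have h0 := congrArg (fun p : E3 => p 0) h
    have h1 := congrArg (fun p : E3 => p 1) h
    have h2 := congrArg (fun p : E3 => p 2) h
    simp at h0 h1 h2
    exact ⟨Complex.ext h1 h0, h2⟩
  · rintro ⟨h1, h2⟩
    rw [Fmap_eq_turned, Fmap_eq_turned, h1, h2]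

/-- x₃ determines Re z, and |T| determines |Im z| by monotonicity. Two conjugate points with the
same image satisfy T = -T, so T = 0 and both lie on the real axis. -/
theorem injOn_Fmap {a : ℝ} (ha : 0 < a) : InjOn (Fmap a) (good a) := by
  intro z hz z' hz' h
  obtain ⟨hT, hx⟩ := Fmap_eq_iff.1 h
  have hn : ‖turned a ⟨z.re, |z.im|⟩‖ = ‖turned a ⟨z'.re, |z'.im|⟩‖ := by
    rw [norm_turned_abs_im ha (good_subset_dom ha hz),
      norm_turned_abs_im ha (good_subset_dom ha hz'), hT]
  have hg := good_abs_im hz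
  have hg' := good_abs_im hz'
  rw [← hx] at hn hg'
  have habs : |z.im| = |z'.im| := by
    apply le_antisymm
    · by_contra! hlt
      exact (norm_turned_lt ha hg (abs_nonneg _) hlt).ne' hn
    · by_contra! hlt
      exact (norm_turned_lt ha hg' (abs_nonneg _) hlt).ne hn
  rcases abs_eq_abs.1 habs with h | h
  · exact Complex.ext hx h
  · have h0 : ‖turned a ⟨z.re, |z.im|⟩‖ = 0 := by
      rw [norm_turned_abs_im ha (good_subset_dom ha hz), norm_eq_zero]
      have hc : z = starRingEnd ℂ z' := Complex.ext hx h
      have hc' : z' = starRingEnd ℂ z := by rw [hc, conj_conj]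
      rcases le_total 0 z'.im with hs | hs
      · have := turned_conj ha (good_subset_dom ha hz') hs
        rw [← hc, ← hT] at this
        exact self_eq_neg.1 this
      · have := turned_conj ha (good_subset_dom ha hz) (by linarith)
        rw [← hc', ← hT] at this
        exact self_eq_neg.1 this
    have hz0 : z.im = 0 := by
      by_contra hne
      have := norm_turned_lt ha hg le_rfl (abs_pos.2 hne)
      rw [h0, turned_mk_zero, norm_zero] at this
      exact lt_irrefl _ this
    exact Complex.ext hx (by rw [hz0] at h ⊢; linarith)

theorem disjoint_graphs {a : ℝ} (ha : 0 < a) (ha2 : a ≤ 1 / 2) :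
    Disjoint (Fmap a '' core a) ((fun z => Fmap a (starRingEnd ℂ z)) '' core a) := by
  rw [Set.disjoint_left]
  rintro _ ⟨z, hz, rfl⟩ ⟨z', hz', h⟩
  have hc := Omega_subset_good ha ha2 ((conj_mem_Omega_iff z').2 (core_subset_Omega ha ha2 hz'))
  have := congrArg im (injOn_Fmap ha hc hz.1.1 h)
  rw [conj_im] at this
  have h1 := hz.1.2
  have h2 := hz'.1.2
  linarith

/-! ### The strip is a smooth disk -/

/-- The region between the graphs of a positive smooth function and of its negative is a smooth
disk: it is diffeomorphic to a strip, hence to the closed unit disk without two boundary points. -/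
theorem isSmoothDisk_of_height {η : ℝ → ℝ} (hη : ContDiff ℝ ∞ η) (hpos : ∀ x, 0 < η x) :
    IsSmoothDisk {z | |z.im| ≤ η z.re} := by
  have hpi := Real.pi_pos
  -- Rescaling to height 1 and exponentiating sends the strip onto the closed right half plane
  -- without 0. The Cayley map then gives the closed disk without ±1, the images of the two ends of
  -- the strip.
  set ζ : ℂ → ℂ := fun z => cexp ((Real.pi / 2 * z.re : ℝ) + (Real.pi / 2 * (z.im / η z.re) : ℝ) * I)
    with hζdef
  set L : ℂ → ℂ := fun w => Complex.log ((1 + w) / (1 - w)) with hLdef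
  have hηc : ContDiff ℝ ∞ (fun z : ℂ => η z.re) := hη.comp reCLM.contDiff
  have hζ : ContDiff ℝ ∞ ζ := by
    refine Complex.contDiff_exp.comp (ContDiff.add ?_ (ContDiff.mul ?_ contDiff_const))
    · exact ofRealCLM.contDiff.comp (contDiff_const.mul reCLM.contDiff)
    · exact ofRealCLM.contDiff.comp (contDiff_const.mul
        (imCLM.contDiff.div hηc fun z => (hpos _).ne'))
  have hratio : ∀ z : ℂ, |z.im| ≤ η z.re → |z.im / η z.re| ≤ 1 := fun z hz => by
    rw [abs_div, abs_of_pos (hpos _), div_le_one (hpos _)]; exact hz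
  have hζre : ∀ z : ℂ, |z.im| ≤ η z.re → 0 ≤ (ζ z).re := by
    intro z hz
    have := abs_le.1 (hratio z hz)
    rw [hζdef]
    simp only [exp_re, add_im, ofReal_im, zero_add, im_ofReal_mul, I_im, mul_one]
    refine mul_nonneg (Real.exp_pos _).le (Real.cos_nonneg_of_mem_Icc ⟨?_, ?_⟩) <;> nlinarith
  have hζ0 : ∀ z, ζ z ≠ 0 := fun z => exp_ne_zero _
  have hζ1 : ∀ z : ℂ, |z.im| ≤ η z.re → ζ z + 1 ≠ 0 := by
    intro z hz h
    have h1 := congrArg re h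
    have h2 := hζre z hz
    simp only [add_re, one_re, zero_re] at h1
    linarith
  -- the closed half plane and the closed disk
  have hdisk : ∀ w : ℂ, w ∈ Metric.closedBall (0 : ℂ) 1 \ {1, -1} →
      1 - w ≠ 0 ∧ 1 + w ≠ 0 ∧ 0 ≤ ((1 + w) / (1 - w)).re := by
    rintro w ⟨hw, hK⟩
    simp only [mem_insert_iff, mem_singleton_iff, not_or] at hK
    have h1 : 1 - w ≠ 0 := fun h => hK.1 (sub_eq_zero.1 h).symm
    refine ⟨h1, fun h => hK.2 (by linear_combination h), ?_⟩
    rw [mem_closedBall_zero_iff] at hw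
    have hn : normSq w ≤ 1 := by
      rw [normSq_eq_norm_sq]; exact pow_le_one₀ (norm_nonneg _) hw
    rw [normSq_apply] at hn
    rw [div_re, ← add_div]
    refine div_nonneg ?_ (normSq_nonneg _)
    simp
    nlinarith
  refine ⟨{1, -1}, (Set.toFinite _).isClosed, ?_, fun z => (ζ z - 1) / (ζ z + 1),
    fun w => ((2 / Real.pi * (L w).re : ℝ) : ℂ) +
      ((2 / Real.pi * (L w).im * η (2 / Real.pi * (L w).re) : ℝ) : ℂ) * I, ?_, ?_, ?_, ?_, ?_, ?_⟩
  · rintro w (rfl | rfl) <;> simp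
  · refine ⟨{z | ζ z + 1 ≠ 0}, isOpen_ne_fun (hζ.continuous.add continuous_const)
      continuous_const, hζ1, ?_⟩
    simp only [div_eq_mul_inv]
    exact (hζ.sub contDiff_const).contDiffOn.mul
      ((hζ.add contDiff_const).contDiffOn.inv fun z hz => hz)
  -- The quotient (1 + w)/(1 - w) meets the cut or the pole only for real w with |w| ≥ 1, so this
  -- open set is safe and still contains the unit circle without ±1.
  · refine ⟨{w | w.re ^ 2 + w.im ^ 2 < 1} ∪ {w | w.im ≠ 0}, (isOpen_lt (by fun_prop)
      (by fun_prop)).union (isOpen_ne_fun continuous_im continuous_const), ?_, ?_⟩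
    · rintro w ⟨hw, hK⟩
      simp only [mem_insert_iff, mem_singleton_iff, not_or] at hK
      rw [mem_closedBall_zero_iff] at hw
      have hn : normSq w ≤ 1 := by
        rw [normSq_eq_norm_sq]; exact pow_le_one₀ (norm_nonneg _) hw
      rw [normSq_apply] at hn
      by_cases him : w.im = 0
      · left
        change w.re ^ 2 + w.im ^ 2 < 1
        refine lt_of_le_of_ne (by linarith [pow_two w.re, pow_two w.im]) fun h => ?_
        rw [him] at h
        have : (w.re - 1) * (w.re + 1) = 0 := by linear_combination h
        rcases mul_eq_zero.1 this with h | h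
        · exact hK.1 (Complex.ext (by simp; linarith) him)
        · exact hK.2 (Complex.ext (by simp; linarith) (by simp [him]))
      · exact Or.inr him
    · have hL : ContDiffOn ℝ ∞ L ({w | w.re ^ 2 + w.im ^ 2 < 1} ∪ {w | w.im ≠ 0}) := by
        intro w hw
        have h1 : 1 - w ≠ 0 := by
          intro h
          have : w = 1 := (sub_eq_zero.1 h).symm
          rw [this] at hw
          rcases hw with hw | hw
          · change (1 : ℂ).re ^ 2 + (1 : ℂ).im ^ 2 < 1 at hw; norm_num at hw
          · exact hw one_im
        have hnp := normSq_pos.2 h1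
        have hslit : (1 + w) / (1 - w) ∈ slitPlane := by
          rw [mem_slitPlane_iff, div_re, div_im, ← add_div, ← sub_div]
          rcases hw with hw | hw
          · left
            have hw' : w.re ^ 2 + w.im ^ 2 < 1 := hw
            refine div_pos ?_ hnp
            simp
            nlinarith
          · right
            refine div_ne_zero ?_ hnp.ne'
            have hw' : w.im ≠ 0 := hw
            simp
            ring_nf
            simpa using hw'
        have hq : ContDiffAt ℝ ∞ (fun w : ℂ => (1 + w) / (1 - w)) w := by
          simp only [div_eq_mul_inv]
          exact (contDiffAt_const.add contDiffAt_id).mul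
            ((contDiffAt_const.sub contDiffAt_id).inv h1)
        exact (((Complex.contDiffAt_log hslit).restrict_scalars ℝ).comp w hq).contDiffWithinAt
      have hre : ContDiffOn ℝ ∞ (fun w => 2 / Real.pi * (L w).re) _ :=
        contDiffOn_const.mul (reCLM.contDiff.comp_contDiffOn hL)
      have him : ContDiffOn ℝ ∞ (fun w => 2 / Real.pi * (L w).im) _ :=
        contDiffOn_const.mul (imCLM.contDiff.comp_contDiffOn hL)
      exact (ofRealCLM.contDiff.comp_contDiffOn hre).add
        ((ofRealCLM.contDiff.comp_contDiffOn (him.mul (hη.comp_contDiffOn hre))).mul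
          contDiffOn_const)
  · intro z hz
    have h1 := hζ1 z hz
    have hre := hζre z hz
    refine ⟨?_, ?_⟩
    · rw [mem_closedBall_zero_iff, norm_div, div_le_one (norm_pos_iff.2 h1)]
      apply le_of_sq_le_sq ?_ (norm_nonneg _)
      rw [← normSq_eq_norm_sq, ← normSq_eq_norm_sq, normSq_apply, normSq_apply]
      simp
      nlinarith
    · rintro (h | h)
      · rw [div_eq_one_iff_eq h1] at h
        have := congrArg re h
        simp at this
        linarith
      · rw [mem_singleton_iff, div_eq_iff h1] at h
        exact hζ0 z (by linear_combination h / 2)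
  · intro w hw
    obtain ⟨h1, h2, h3⟩ := hdisk w hw
    have harg : |(L w).im| ≤ Real.pi / 2 := by
      rw [hLdef]; simp only [log_im]; exact abs_arg_le_pi_div_two_iff.2 h3
    change |_| ≤ η _
    simp only [add_re, add_im, ofReal_re, ofReal_im, re_ofReal_mul, im_ofReal_mul, I_re, I_im,
      mul_zero, mul_one, add_zero, zero_add]
    rw [abs_mul, abs_mul, abs_of_pos (hpos _), abs_of_pos (a := 2 / Real.pi) (by positivity)]
    have : 2 / Real.pi * |(L w).im| ≤ 1 := by
      calc 2 / Real.pi * |(L w).im| ≤ 2 / Real.pi * (Real.pi / 2) := by gcongr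
        _ = 1 := by field_simp
    exact mul_le_of_le_one_left (hpos _).le this
  · intro z hz
    have h1 := hζ1 z hz
    have e1 : (1 + (ζ z - 1) / (ζ z + 1)) / (1 - (ζ z - 1) / (ζ z + 1)) = ζ z := by
      have e2 : 1 - (ζ z - 1) / (ζ z + 1) = 2 / (ζ z + 1) := by field_simp; ring
      rw [e2]
      field_simp
      ring
    have hr := abs_le.1 (hratio z hz)
    have e3 : L ((ζ z - 1) / (ζ z + 1)) =
        (Real.pi / 2 * z.re : ℝ) + (Real.pi / 2 * (z.im / η z.re) : ℝ) * I := by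
      rw [hLdef]
      simp only [e1]
      refine Complex.log_exp ?_ ?_ <;>
        simp only [add_im, ofReal_im, zero_add, im_ofReal_mul, I_im, mul_one] <;> nlinarith
    have e4 : (L ((ζ z - 1) / (ζ z + 1))).re = Real.pi / 2 * z.re := by
      rw [e3]; simp only [add_re, ofReal_re, re_ofReal_mul, I_re, mul_zero, add_zero]
    have e5 : (L ((ζ z - 1) / (ζ z + 1))).im = Real.pi / 2 * (z.im / η z.re) := by
      rw [e3]; simp only [add_im, ofReal_im, zero_add, im_ofReal_mul, I_im, mul_one]
    have e6 : 2 / Real.pi * (Real.pi / 2 * z.re) = z.re := by field_simp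
    have e7 : 2 / Real.pi * (Real.pi / 2 * (z.im / η z.re)) * η z.re = z.im := by
      have := (hpos z.re).ne'
      field_simp
    simp only [e4, e5, e6, e7, re_add_im]
  · intro w hw
    obtain ⟨h1, h2, h3⟩ := hdisk w hw
    have hne : (1 + w) / (1 - w) ≠ 0 := div_ne_zero h2 h1
    have e1 : ζ (((2 / Real.pi * (L w).re : ℝ) : ℂ) +
        ((2 / Real.pi * (L w).im * η (2 / Real.pi * (L w).re) : ℝ) : ℂ) * I) =
        (1 + w) / (1 - w) := by
      rw [hζdef]
      simp only [add_re, add_im, ofReal_re, ofReal_im, re_ofReal_mul, im_ofReal_mul, I_re, I_im,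
        mul_zero, mul_one, add_zero, zero_add]
      have e2 : Real.pi / 2 * (2 / Real.pi * (L w).re) = (L w).re := by field_simp
      have e3 : Real.pi / 2 * (2 / Real.pi * (L w).im * η (2 / Real.pi * (L w).re) /
          η (2 / Real.pi * (L w).re)) = (L w).im := by
        rw [mul_div_cancel_right₀ _ (hpos _).ne']; field_simp
      rw [e2, e3, re_add_im, hLdef]
      exact Complex.exp_log hne
    simp only [e1]
    have e2 : (1 + w) / (1 - w) + 1 = 2 / (1 - w) := by field_simp; ring
    rw [e2]
    field_simp
    ring

/-! ### Immersion and vanishing mean curvature -/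

theorem fderiv_reVec {p₀ p₁ p₂ : ℂ → ℂ} {d₀ d₁ d₂ z : ℂ} (h₀ : HasDerivAt p₀ d₀ z)
    (h₁ : HasDerivAt p₁ d₁ z) (h₂ : HasDerivAt p₂ d₂ z) (w : ℂ) :
    fderiv ℝ (fun z => (!₂[(p₀ z).re, (p₁ z).re, (p₂ z).re] : E3)) z w =
      !₂[(d₀ * w).re, (d₁ * w).re, (d₂ * w).re] := by
  have k : ∀ {p : ℂ → ℂ} {d : ℂ}, HasDerivAt p d z → HasFDerivAt (fun z => (p z).re)
      (reCLM.comp ((ContinuousLinearMap.toSpanSingleton ℂ d).restrictScalars ℝ)) z :=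
    fun h => reCLM.hasFDerivAt.comp z (h.hasFDerivAt.restrictScalars ℝ)
  have hd : DifferentiableAt ℝ (fun z => (!₂[(p₀ z).re, (p₁ z).re, (p₂ z).re] : E3)) z := by
    rw [differentiableAt_euclidean]
    intro i
    fin_cases i
    · exact (k h₀).differentiableAt
    · exact (k h₁).differentiableAt
    · exact (k h₂).differentiableAt
  have hc : ∀ i : Fin 3, _ := fun i =>
    ((EuclideanSpace.proj i : E3 →L[ℝ] ℝ).hasFDerivAt.comp z hd.hasFDerivAt)
  ext i
  fin_cases i
  · simpa [mul_comm] using congrArg (fun L : ℂ →L[ℝ] ℝ => L w) ((hc 0).unique (k h₀))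
  · simpa [mul_comm] using congrArg (fun L : ℂ →L[ℝ] ℝ => L w) ((hc 1).unique (k h₁))
  · simpa [mul_comm] using congrArg (fun L : ℂ →L[ℝ] ℝ => L w) ((hc 2).unique (k h₂))

theorem Fmap_eq_fun (a : ℝ) :
    Fmap a = fun z => (!₂[(primS a z).re, (primC a z).re, (id z).re] : E3) :=
  funext fun z => Fmap_eq a z

theorem fderiv_Fmap {a : ℝ} (ha : 0 < a) {z : ℂ} (hz : z ∈ dom a) (w : ℂ) :
    fderiv ℝ (Fmap a) z w = !₂[(-I * Complex.sin (expo a z) * w).re,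
      (I * Complex.cos (expo a z) * w).re, (1 * w).re] := by
  rw [Fmap_eq_fun]
  exact fderiv_reVec (hasDerivAt_primS ha hz) (hasDerivAt_primC ha hz) (hasDerivAt_id z) w

/-- The real part of this identity gives E = G and its imaginary part gives F = 0: the immersion is
conformal. -/
theorem null_curve (h : ℂ) :
    (-I * Complex.sin h) ^ 2 + (I * Complex.cos h) ^ 2 + 1 ^ 2 = 0 := by
  linear_combination (Complex.sin h ^ 2 + Complex.cos h ^ 2) * I_sq - Complex.sin_sq_add_cos_sq h

/-- The third component forces a kernel vector to be imaginary. If it were nonzero, the first two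
forms A and B would be real, contradicting A² + B² = -1. -/
theorem injective_fderiv_Fmap {a : ℝ} (ha : 0 < a) {z : ℂ} (hz : z ∈ dom a) :
    Function.Injective (fderiv ℝ (Fmap a) z) := by
  rw [injective_iff_map_eq_zero]
  intro w hw
  rw [fderiv_Fmap ha hz] at hw
  have hnull := null_curve (expo a z)
  generalize -I * Complex.sin (expo a z) = A at *
  generalize I * Complex.cos (expo a z) = B at *
  have h0 := congrArg (fun p : E3 => p 0) hw
  have h1 := congrArg (fun p : E3 => p 1) hw
  have h2 := congrArg (fun p : E3 => p 2) hw
  simp at h0 h1 h2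
  rw [h2] at h0 h1
  refine Complex.ext h2 ?_
  by_contra hne
  have hA : A.im = 0 := by simpa [show w.im ≠ 0 from hne] using h0
  have hB : B.im = 0 := by simpa [show w.im ≠ 0 from hne] using h1
  have := congrArg re hnull
  simp [pow_two, hA, hB] at this
  nlinarith [mul_self_nonneg A.re, mul_self_nonneg B.re]

/-- The coordinates are harmonic, so X_xx = -X_yy, and the parametrization is conformal; the
numerator eG - 2fF + gE becomes (e + g)E = 0. -/
theorem meanCurvature_Fmap {a : ℝ} (ha : 0 < a) {z : ℂ} (hz : z ∈ dom a) :
    meanCurvature (Fmap a) z = 0 := by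
  have hnear := (isOpen_dom a).mem_nhds hz
  have hx : ∀ w ∈ dom a, dx (Fmap a) w = !₂[(-I * Complex.sin (expo a w)).re,
      (I * Complex.cos (expo a w)).re, (1 : ℂ).re] := fun w hw => by
    rw [dx, fderiv_Fmap ha hw]; simp only [mul_one]
  have hy : ∀ w ∈ dom a, dy (Fmap a) w = !₂[(-I * Complex.sin (expo a w) * I).re,
      (I * Complex.cos (expo a w) * I).re, (1 * I : ℂ).re] := fun w hw => by
    rw [dy, fderiv_Fmap ha hw]
  have hS := (hasDerivAt_expo ha hz).csin.const_mul (-I)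
  have hC := (hasDerivAt_expo ha hz).ccos.const_mul I
  have hxx : dx (dx (Fmap a)) z = -dy (dy (Fmap a)) z := by
    have e1 : dx (Fmap a) =ᶠ[𝓝 z] _ := Filter.mem_of_superset hnear hx
    have e2 : dy (Fmap a) =ᶠ[𝓝 z] _ := Filter.mem_of_superset hnear hy
    rw [dx, dy, e1.fderiv_eq, e2.fderiv_eq, fderiv_reVec hS hC (hasDerivAt_const z 1),
      fderiv_reVec (hS.mul_const I) (hC.mul_const I) (hasDerivAt_const z (1 * I))]
    simp only [mul_assoc _ I I, I_mul_I, mul_one, mul_neg, zero_mul]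
    ext i
    fin_cases i <;> simp
  have hnull := null_curve (expo a z)
  have hE : inner ℝ (dx (Fmap a) z) (dx (Fmap a) z) =
      (inner ℝ (dy (Fmap a) z) (dy (Fmap a) z) : ℝ) := by
    rw [hx z hz, hy z hz]
    generalize -I * Complex.sin (expo a z) = A at *
    generalize I * Complex.cos (expo a z) = B at *
    have := congrArg re hnull
    simp [pow_two] at this
    simp only [PiLp.inner_apply, Fin.sum_univ_three]
    simp
    linarith
  have hF : (inner ℝ (dx (Fmap a) z) (dy (Fmap a) z) : ℝ) = 0 := by
    rw [hx z hz, hy z hz]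
    generalize -I * Complex.sin (expo a z) = A at *
    generalize I * Complex.cos (expo a z) = B at *
    have := congrArg im hnull
    simp [pow_two] at this
    simp only [PiLp.inner_apply, Fin.sum_univ_three]
    simp
    linarith
  rw [meanCurvature, hxx, hE, hF, inner_neg_left]
  ring_nf

theorem contDiffOn_Fmap {a : ℝ} (ha : 0 < a) : ContDiffOn ℝ ∞ (Fmap a) (dom a) := by
  have h1 := contDiffOn_of_hasDerivAt (isOpen_dom a) (fun z hz => hasDerivAt_primS ha hz)
  have h2 := contDiffOn_of_hasDerivAt (isOpen_dom a) (fun z hz => hasDerivAt_primC ha hz)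
  rw [Fmap_eq_fun, contDiffOn_euclidean]
  intro i
  fin_cases i
  · exact reCLM.contDiff.comp_contDiffOn h1
  · exact reCLM.contDiff.comp_contDiffOn h2
  · exact reCLM.contDiff.contDiffOn

/-! ### Boundaries, properness and conclusion -/

theorem isClosed_cylinder (R : ℝ) : IsClosed (cylinder R) :=
  isClosed_le (by fun_prop) (by fun_prop)

theorem mem_frontier_cylinder_iff {R : ℝ} (hR : 0 < R) (p : E3) :
    p ∈ frontier (cylinder R) ↔ p 0 ^ 2 + p 1 ^ 2 = R ^ 2 := by
  constructor
  · intro h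
    exact frontier_le_subset_eq (by fun_prop) (by fun_prop) h
  · intro h
    rw [(isClosed_cylinder R).frontier_eq]
    refine ⟨h.le, fun hint => ?_⟩
    -- Dilating by t slightly above 1 leaves the cylinder, so a point at distance R from the axis is
    -- not interior.
    have hc : ContinuousAt (fun t : ℝ => t • p) 1 := by fun_prop
    have hev : ∀ᶠ t in 𝓝 (1 : ℝ), t • p ∈ cylinder R :=
      hc.eventually (by beta_reduce; rw [one_smul]; exact mem_interior_iff_mem_nhds.1 hint)
    obtain ⟨t, ht, ht1⟩ := ((hev.filter_mono nhdsWithin_le_nhds).and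
      (self_mem_nhdsWithin : Ioi (1 : ℝ) ∈ 𝓝[>] 1)).exists
    have ht' : (t • p) 0 ^ 2 + (t • p) 1 ^ 2 ≤ R ^ 2 := ht
    have ht1' : 1 < t := ht1
    simp only [PiLp.smul_apply, smul_eq_mul] at ht'
    have h2 : t ^ 2 * R ^ 2 ≤ R ^ 2 := by rw [← h]; linarith
    have h3 : 1 < t ^ 2 := one_lt_pow₀ ht1' two_ne_zero
    have h4 : 0 < R ^ 2 := by positivity
    nlinarith

theorem mem_frontier_strip_iff {η : ℝ → ℝ} (hη : Continuous η) (hpos : ∀ x, 0 < η x) (z : ℂ) :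
    z ∈ frontier {z : ℂ | |z.im| ≤ η z.re} ↔ |z.im| = η z.re := by
  have hc1 : Continuous (fun z : ℂ => |z.im|) := continuous_im.abs
  have hc2 : Continuous (fun z : ℂ => η z.re) := hη.comp continuous_re
  constructor
  · intro h
    exact frontier_le_subset_eq hc1 hc2 h
  · intro h
    rw [(isClosed_le hc1 hc2).frontier_eq]
    refine ⟨h.le, fun hint => ?_⟩
    have hc : ContinuousAt (fun t : ℝ => (z.re : ℂ) + ((t * z.im : ℝ) : ℂ) * I) 1 := by fun_prop
    have hev : ∀ᶠ t : ℝ in 𝓝 (1 : ℝ), (z.re : ℂ) + ((t * z.im : ℝ) : ℂ) * I ∈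
        {z : ℂ | |z.im| ≤ η z.re} :=
      hc.eventually (by
        beta_reduce; rw [one_mul, re_add_im]; exact mem_interior_iff_mem_nhds.1 hint)
    obtain ⟨t, ht, ht1⟩ := ((hev.filter_mono nhdsWithin_le_nhds).and
      (self_mem_nhdsWithin : Ioi (1 : ℝ) ∈ 𝓝[>] 1)).exists
    have ht1' : 1 < t := ht1
    have ht' : |((z.re : ℂ) + ((t * z.im : ℝ) : ℂ) * I).im| ≤
      η ((z.re : ℂ) + ((t * z.im : ℝ) : ℂ) * I).re := ht
    simp only [add_re, add_im, ofReal_re, ofReal_im, re_ofReal_mul, im_ofReal_mul, I_re, I_im,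
      mul_zero, mul_one, add_zero, zero_add] at ht'
    rw [abs_mul, h, abs_of_pos (by linarith)] at ht'
    nlinarith [hpos z.re]

theorem isProperlyEmbeddedMinimalDisk_Fmap {a : ℝ} (ha : 0 < a) (ha2 : a ≤ 1 / 2) :
    IsProperlyEmbeddedMinimalDisk (Fmap a) (Omega a ∩ Fmap a ⁻¹' cylinder radius)
      (cylinder radius) (Sigma a ∩ cylinder radius) := by
  have hη := contDiff_height ha ha2 radius_pos le_rfl
  have hpos : ∀ x, 0 < height a radius x := fun x => (height_spec ha ha2 radius_pos le_rfl x).1.2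
  have hD := Omega_inter_preimage ha ha2
  have hgood : Omega a ∩ Fmap a ⁻¹' cylinder radius ⊆ good a := fun z hz =>
    Omega_subset_good ha ha2 hz.1
  have hdom : Omega a ∩ Fmap a ⁻¹' cylinder radius ⊆ dom a :=
    hgood.trans (good_subset_dom ha)
  refine ⟨?_, ⟨dom a, isOpen_dom a, hdom, contDiffOn_Fmap ha⟩,
    fun z hz => injective_fderiv_Fmap ha (hdom hz), fun z hz => meanCurvature_Fmap ha (hdom hz),
    (injOn_Fmap ha).mono hgood, image_inter_preimage _ _ _, fun z hz => hz.2, ?_, ?_⟩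
  · rw [hD]
    exact isSmoothDisk_of_height hη hpos
  · intro Q hQ hQc
    have hclosed : IsClosed (Omega a ∩ Fmap a ⁻¹' cylinder radius) := by
      rw [hD]
      exact isClosed_le continuous_im.abs (hη.continuous.comp continuous_re)
    have hcl : IsClosed ((Omega a ∩ Fmap a ⁻¹' cylinder radius) ∩ Fmap a ⁻¹' Q) :=
      ((contDiffOn_Fmap ha).continuousOn.mono hdom).preimage_isClosed_of_isClosed hclosed
        hQc.isClosed
    -- Since x₃ = Re z, a bound on `Q` bounds Re z, while |Im z| ≤ 1/10 throughout the strip.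
    obtain ⟨M, hM⟩ := hQc.isBounded.exists_norm_le
    refine Metric.isCompact_of_isClosed_isBounded hcl
      (isBounded_iff_forall_norm_le.2 ⟨M + 1 / 10, ?_⟩)
    rintro z ⟨hz, hzQ⟩
    rw [hD] at hz
    have h1 : |z.im| ≤ 1 / 10 :=
      le_trans hz (height_bounds ha ha2 radius_pos le_rfl z.re).1.le
    have h2 : |z.re| ≤ M := by
      have := (PiLp.norm_apply_le (Fmap a z) 2).trans (hM _ hzQ)
      rw [Fmap_eq] at this
      simpa using this
    exact (norm_le_abs_re_add_abs_im z).trans (by linarith)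
  · intro z hz
    rw [mem_frontier_cylinder_iff radius_pos, Fmap_sq_add_sq,
      pow_left_inj₀ (norm_nonneg _) radius_pos.le two_ne_zero, hD,
      mem_frontier_strip_iff hη.continuous hpos, ← norm_turned_abs_im ha (hdom hz)]
    have hg := good_abs_im (hgood hz)
    rw [le_antisymm_iff, le_antisymm_iff]
    exact and_congr (norm_turned_le_radius_iff ha ha2 radius_pos le_rfl hg (abs_nonneg _))
      (not_lt.symm.trans ((not_congr (norm_turned_lt_radius_iff ha ha2 radius_pos le_rfl hg
        (abs_nonneg _))).trans not_lt))

end HelicoidalDisks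

theorem mainTheorem2 :
    ∃ R₀ : ℝ, 0 < R₀ ∧ ∀ a : ℝ, 0 < a → a ≤ 1 / 2 →
      HelicoidalDisks.IsProperlyEmbeddedMinimalDisk (HelicoidalDisks.Fmap a)
        (HelicoidalDisks.Omega a ∩ HelicoidalDisks.Fmap a ⁻¹' HelicoidalDisks.cylinder R₀)
        (HelicoidalDisks.cylinder R₀)
        (HelicoidalDisks.Sigma a ∩ HelicoidalDisks.cylinder R₀) ∧
      ∃ S₁ S₂ : Set HelicoidalDisks.E3,
        HelicoidalDisks.puncturedCylinder R₀ ∩ HelicoidalDisks.Sigma a = S₁ ∪ S₂ ∧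
        Disjoint S₁ S₂ ∧
        HelicoidalDisks.IsMultivaluedGraph R₀ S₁ ∧
        HelicoidalDisks.IsMultivaluedGraph R₀ S₂ := by
  open HelicoidalDisks in
  refine ⟨radius, radius_pos, fun a ha ha2 => ⟨isProperlyEmbeddedMinimalDisk_Fmap ha ha2, _, _,
    puncturedCylinder_inter_Sigma ha ha2, disjoint_graphs ha ha2,
    isMultivaluedGraph_upper ha ha2, isMultivaluedGraph_lower ha ha2⟩⟩
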